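/- Let $n\ge 3$ and $\varepsilon=(\varepsilon_1,\varepsilon_2,\varepsilon_3)\in\mathbb R^3$. Let $\mathfrak g_n(\varepsilon)$ be the real Lie algebra with generators $l_{ij}=-l_{ji}$, $x_i$, $p_i$ ($1\le i,j\le n$) and $I$ (the $l_{ij}$ with $i<j$, the $x_i$, the $p_i$ and $I$ forming a basis) and brackets $$[l_{ij},l_{km}]=\delta_{ik}l_{jm}-\delta_{im}l_{jk}+\delta_{jm}l_{ik}-\delta_{jk}l_{im},\quad [l_{ij},x_k]=\delta_{ik}x_j-\delta_{jk}x_i,\quad [l_{ij},p_k]=\delta_{ik}p_j-\delta_{jk}p_i,\quad [l_{ij},I]=0,$$ $$[x_i,x_j]=\varepsilon_1l_{ij},\quad [p_i,p_j]=\varepsilon_2l_{ij},\quad [x_i,p_j]=\delta_{ij}I+\varepsilon_3l_{ij},\quad [x_i,I]=\varepsilon_3x_i-\varepsilon_1p_i,\quad [p_i,I]=\varepsilon_2x_i-\varepsilon_3p_i .$$ Regard the generators as linear coordinates on the dual space $\mathfrak g_n(\varepsilon)^\vee$. The special coadjoint orbit $\mathcal O_{2n}(\varepsilon)\subset\mathfrak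 g_n(\varepsilon)^\vee$ is the set of points at which $$I^2+\varepsilon_2\sum_i x_i^2+\varepsilon_1\sum_i p_i^2-2\varepsilon_3\sum_i x_ip_i-(\varepsilon_3^2-\varepsilon_1\varepsilon_2)\sum_{i<j}l_{ij}^2=1$$ and the Plücker relations $Il_{ij}=x_ip_j-x_jp_i$, $\ l_{ij}x_k-l_{ik}x_j+l_{jk}x_i=0$, $\ l_{ij}p_k-l_{ik}p_j+l_{jk}p_i=0$, $\ l_{ij}l_{km}=l_{ik}l_{jm}-l_{im}l_{jk}$ hold for all indices. For a subset $S$ of $\mathfrak g_n(\varepsilon)^\vee$ and a smooth manifold $M$, "$S$ is symplectomorphic to $T^*M$" means: there is a smooth embedding $\Phi:T^*M\to\mathfrak g_n(\varepsilon)^\vee$ with image $S$, such that $T_\xi S=\{\mathrm{ad}^*_X\xi: X\in\mathfrak g_n(\varepsilon)\}$ for all $\xi\in S$, and such that $\Phi$ pulls back the Kirillov–Kostant–Souriau form $\omega_\xi(\mathrm{ad}^*_X\xi,\mathrm{ad}^*_Y\xi)=\xi([X,Y])$ to the standard symplectic form $\omega=-d\theta$ of $T^*M$, where $\theta$ is the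 tautological one-form. Let $\mathcal C_+$ (respectively $\mathcal C_-$) be the set of $\varepsilon\in\mathbb R^3\setminus\{0\}$ with $\varepsilon_3^2=\varepsilon_1\varepsilon_2$ and $\varepsilon_1,\varepsilon_2\ge0$ (respectively $\varepsilon_1,\varepsilon_2\le0$). 1. If $\varepsilon\in\mathcal C_+$, then $\mathcal O_{2n}(\varepsilon)$ is symplectomorphic to $T^*S^n$, where $S^n$ is the unit sphere in $\mathbb R^{n+1}$. 2. If $\varepsilon\in\mathcal C_-$, then $\mathcal O_{2n}(\varepsilon)$ is the disjoint union of the non-empty sets $\mathcal O^+_{2n}(\varepsilon)=\mathcal O_{2n}(\varepsilon)\cap\{I>0\}$ and $\mathcal O^-_{2n}(\varepsilon)=\mathcal O_{2n}(\varepsilon)\cap\{I<0\}$, these are its two connected components, and each of them is symplectomorphic to $T^*\mathbb H^n$, where $\mathbb H^n$ is hyperbolic space (the sheet $t>0$ of the hyperboloid $t^2-|y|^2=1$ in $\mathbb R\times\mathbb R^n$). -/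

import Mathlib

open Set Topology Bundle
open scoped Manifold ContDiff Matrix

noncomputable section

/-! ### The deformed Lie algebras -/

/-- The real deformation parameters `(ε₁, ε₂, ε₃)`. -/
@[ext]
structure Params where
  ε₁ : ℝ
  ε₂ : ℝ
  ε₃ : ℝ

/-- The component `𝒞₊` of the cone over the real flat conic: nonzero triples with
`ε₃² = ε₁ ε₂` and `ε₁, ε₂ ≥ 0`. -/
def Cplus : Set Params :=
  {ε | ε ≠ ⟨0, 0, 0⟩ ∧ ε.ε₃ ^ 2 = ε.ε₁ * ε.ε₂ ∧ 0 ≤ ε.ε₁ ∧ 0 ≤ ε.ε₂}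

/-- The component `𝒞₋` of the cone over the real flat conic: nonzero triples with
`ε₃² = ε₁ ε₂` and `ε₁, ε₂ ≤ 0`. -/
def Cminus : Set Params :=
  {ε | ε ≠ ⟨0, 0, 0⟩ ∧ ε.ε₃ ^ 2 = ε.ε₁ * ε.ε₂ ∧ ε.ε₁ ≤ 0 ∧ ε.ε₂ ≤ 0}

/-- Indices `1, …, n` (left summand) together with `n + 1`, `n + 2` (right summand). -/
abbrev Idx (n : ℕ) : Type := Fin n ⊕ Fin 2

/-- Gram matrix of the deformed bilinear form on `ℝⁿ⁺²`: the standard one on `ℝⁿ`, and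
`(v_{n+1}, v_{n+1}) = ε₁`, `(v_{n+2}, v_{n+2}) = ε₂`, `(v_{n+1}, v_{n+2}) = ε₃` on the plane
spanned by the last two basis vectors, which is orthogonal to `ℝⁿ`. -/
def deformedGram (n : ℕ) (ε : Params) : Matrix (Idx n) (Idx n) ℝ :=
  Matrix.fromBlocks 1 0 0 !![ε.ε₁, ε.ε₃; ε.ε₃, ε.ε₂]

/-- Skew-symmetric arrays, i.e. bivectors in `⋀² ℝⁿ⁺²`. -/
def skewArrays (n : ℕ) : Submodule ℝ (Idx n → Idx n → ℝ) where
  carrier := {A | ∀ a b, A b a = - A a b}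
  add_mem' := by
    intro A B hA hB a b
    simp only [Pi.add_apply, hA a b, hB a b]
    ring
  zero_mem' := by intro a b; simp
  smul_mem' := by
    intro c A hA a b
    simp only [Pi.smul_apply, hA a b, smul_eq_mul]
    ring

/-- The underlying space of the Lie algebra `𝔤ₙ(ε)`: bivectors in `ℝⁿ⁺²`. The bracket, which is
where `ε` enters, is defined below; its values on the standard basis are the lemmas
`lie_l_l`, …, `lie_p_I`. The norm only serves to make this finite-dimensional space a normed
space. -/
def DefLie (n : ℕ) (_ε : Params) : Type := ↥(skewArrays n)

namespace DefLie

variable {n : ℕ} {ε : Params}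

instance : NormedAddCommGroup (DefLie n ε) := inferInstanceAs (NormedAddCommGroup (skewArrays n))
instance : NormedSpace ℝ (DefLie n ε) := inferInstanceAs (NormedSpace ℝ (skewArrays n))
instance : FiniteDimensional ℝ (DefLie n ε) :=
  inferInstanceAs (FiniteDimensional ℝ (skewArrays n))

/-- The skew-symmetric matrix of a bivector. -/
def toMat (X : DefLie n ε) : Matrix (Idx n) (Idx n) ℝ := Matrix.of X.1

theorem toMat_transpose (X : DefLie n ε) : (toMat X)ᵀ = - toMat X := by
  ext a b
  exact X.2 a b

/-- The bivector of a skew-symmetric matrix. -/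
def ofMat (A : Matrix (Idx n) (Idx n) ℝ) (h : Aᵀ = -A) : DefLie n ε :=
  ⟨fun a b => A a b, fun a b => congrFun (congrFun h a) b⟩

@[simp] theorem toMat_ofMat (A : Matrix (Idx n) (Idx n) ℝ) (h : Aᵀ = -A) :
    toMat (ofMat A h : DefLie n ε) = A := rfl

theorem toMat_injective : Function.Injective (toMat : DefLie n ε → _) := by
  intro X Y h
  apply Subtype.ext
  funext a b
  exact congrFun (congrFun h a) b

@[simp] theorem toMat_add (X Y : DefLie n ε) : toMat (X + Y) = toMat X + toMat Y := rfl
@[simp] theorem toMat_sub (X Y : DefLie n ε) : toMat (X - Y) = toMat X - toMat Y := rfl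
@[simp] theorem toMat_neg (X : DefLie n ε) : toMat (-X) = -toMat X := rfl
@[simp] theorem toMat_zero : toMat (0 : DefLie n ε) = 0 := rfl
@[simp] theorem toMat_smul (c : ℝ) (X : DefLie n ε) : toMat (c • X) = c • toMat X := rfl

theorem deformedGram_transpose : (deformedGram n ε)ᵀ = deformedGram n ε := by
  rw [deformedGram, Matrix.fromBlocks_transpose]
  congr 1
  · simp
  · ext i j; fin_cases i <;> fin_cases j <;> rfl

/-- The Lie bracket of bivectors induced by the bilinear form with Gram matrix `S`: the bivector
`v ∧ w` acts by `L u = (v, u) w - (w, u) v`, and `[v ∧ w, s ∧ t] = L s ∧ t + s ∧ L t`. On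
skew-symmetric matrices this reads `[A, B] = B S A - A S B`. -/
instance : Bracket (DefLie n ε) (DefLie n ε) where
  bracket X Y := ofMat (toMat Y * deformedGram n ε * toMat X - toMat X * deformedGram n ε * toMat Y) (by
    simp only [Matrix.transpose_sub, Matrix.transpose_mul, toMat_transpose, deformedGram_transpose,
      Matrix.mul_neg, Matrix.neg_mul, Matrix.mul_assoc]
    abel)

@[simp] theorem toMat_lie (X Y : DefLie n ε) :
    toMat ⁅X, Y⁆ = toMat Y * deformedGram n ε * toMat X - toMat X * deformedGram n ε * toMat Y := rfl

instance : LieRing (DefLie n ε) where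
  add_lie X Y Z := toMat_injective (by simp only [toMat_lie, toMat_add]; noncomm_ring)
  lie_add X Y Z := toMat_injective (by simp only [toMat_lie, toMat_add]; noncomm_ring)
  lie_self X := toMat_injective (by simp)
  leibniz_lie X Y Z := toMat_injective (by simp only [toMat_lie, toMat_add]; noncomm_ring)

instance : LieAlgebra ℝ (DefLie n ε) where
  lie_smul c X Y := toMat_injective (by
    simp only [toMat_lie, toMat_smul, Matrix.smul_mul, Matrix.mul_smul, smul_sub])

/-- The bivector `v_a ∧ v_b`. -/
def wedge (n : ℕ) (ε : Params) (a b : Idx n) : DefLie n ε :=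
  ofMat (Matrix.single a b 1 - Matrix.single b a 1) (by
    simp [Matrix.transpose_sub])

/-- The rotation generator `𝐥ᵢⱼ = vᵢ ∧ vⱼ`. -/
def l (n : ℕ) (ε : Params) (i j : Fin n) : DefLie n ε := wedge n ε (.inl i) (.inl j)

/-- The generator `𝐱ᵢ = vᵢ ∧ v_{n+1}`. -/
def x (n : ℕ) (ε : Params) (i : Fin n) : DefLie n ε := wedge n ε (.inl i) (.inr 0)

/-- The generator `𝐩ᵢ = vᵢ ∧ v_{n+2}`. -/
def p (n : ℕ) (ε : Params) (i : Fin n) : DefLie n ε := wedge n ε (.inl i) (.inr 1)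

/-- The generator `𝐈 = v_{n+1} ∧ v_{n+2}`, central when `ε = 0`. -/
def I (n : ℕ) (ε : Params) : DefLie n ε := wedge n ε (.inr 0) (.inr 1)

/-- Kronecker delta. -/
def δ (i j : Fin n) : ℝ := if i = j then 1 else 0

theorem lie_wedge_wedge (a b c d : Idx n) :
    ⁅wedge n ε a b, wedge n ε c d⁆ =
      deformedGram n ε a c • wedge n ε b d - deformedGram n ε a d • wedge n ε b c
        + deformedGram n ε b d • wedge n ε a c - deformedGram n ε b c • wedge n ε a d := by
  have hs : ∀ a b, deformedGram n ε a b = deformedGram n ε b a := fun a b =>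
    congrFun (congrFun (deformedGram_transpose (n := n) (ε := ε)) b) a
  apply toMat_injective
  simp only [toMat_lie, toMat_add, toMat_sub, toMat_smul, wedge, toMat_ofMat, Matrix.sub_mul,
    Matrix.mul_sub, Matrix.single_mul_mul_single, hs c a, hs c b, hs d a, hs d b, smul_sub,
    Matrix.smul_single, one_mul, mul_one, smul_eq_mul]
  abel

theorem wedge_self (a : Idx n) : wedge n ε a a = 0 := toMat_injective (by simp [wedge])

theorem wedge_swap (a b : Idx n) : wedge n ε b a = - wedge n ε a b :=
  toMat_injective (by simp [wedge])

theorem deformedGram_inl_inl (i j : Fin n) : deformedGram n ε (.inl i) (.inl j) = δ i j := by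
  simp [deformedGram, δ, Matrix.one_apply]

/-! The commutation relations of the generators. -/

theorem lie_l_l (i j k m : Fin n) : ⁅l n ε i j, l n ε k m⁆ =
    δ i k • l n ε j m - δ i m • l n ε j k + δ j m • l n ε i k - δ j k • l n ε i m := by
  simp only [l, lie_wedge_wedge, deformedGram_inl_inl]

theorem lie_l_x (i j k : Fin n) :
    ⁅l n ε i j, x n ε k⁆ = δ i k • x n ε j - δ j k • x n ε i := by
  simp [l, x, lie_wedge_wedge, deformedGram, δ, Matrix.one_apply]

theorem lie_l_p (i j k : Fin n) :
    ⁅l n ε i j, p n ε k⁆ = δ i k • p n ε j - δ j k • p n ε i := by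
  simp [l, p, lie_wedge_wedge, deformedGram, δ, Matrix.one_apply]

theorem lie_l_I (i j : Fin n) : ⁅l n ε i j, I n ε⁆ = 0 := by
  simp [l, I, lie_wedge_wedge, deformedGram]

theorem lie_x_x (i j : Fin n) : ⁅x n ε i, x n ε j⁆ = ε.ε₁ • l n ε i j := by
  simp [x, l, lie_wedge_wedge, deformedGram, wedge_self]

theorem lie_p_p (i j : Fin n) : ⁅p n ε i, p n ε j⁆ = ε.ε₂ • l n ε i j := by
  simp [p, l, lie_wedge_wedge, deformedGram, wedge_self]

theorem lie_x_p (i j : Fin n) :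
    ⁅x n ε i, p n ε j⁆ = δ i j • I n ε + ε.ε₃ • l n ε i j := by
  simp [x, p, l, I, lie_wedge_wedge, deformedGram, δ, Matrix.one_apply]

theorem lie_x_I (i : Fin n) : ⁅x n ε i, I n ε⁆ = ε.ε₃ • x n ε i - ε.ε₁ • p n ε i := by
  simp [x, p, I, lie_wedge_wedge, deformedGram]

theorem lie_p_I (i : Fin n) : ⁅p n ε i, I n ε⁆ = ε.ε₂ • x n ε i - ε.ε₃ • p n ε i := by
  simp [x, p, I, lie_wedge_wedge, deformedGram]

end DefLie

/-! ### The special coadjoint orbits -/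

/-- The dual space `𝔤ₙ(ε)^∨`, on which the elements of `𝔤ₙ(ε)` are linear coordinates. -/
abbrev DefLieDual (n : ℕ) (ε : Params) : Type := DefLie n ε →L[ℝ] ℝ

/-- The quadratic Casimir function
`C₂ = -2 (I² + ε₂ x² + ε₁ p² - 2 ε₃ x·p - (ε₃² - ε₁ ε₂) l²)` on `𝔤ₙ(ε)^∨`. -/
def casimir (n : ℕ) (ε : Params) (ξ : DefLieDual n ε) : ℝ :=
  -2 * (ξ (DefLie.I n ε) ^ 2
    + ε.ε₂ * ∑ i, ξ (DefLie.x n ε i) ^ 2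
    + ε.ε₁ * ∑ i, ξ (DefLie.p n ε i) ^ 2
    - 2 * ε.ε₃ * ∑ i, ξ (DefLie.x n ε i) * ξ (DefLie.p n ε i)
    - (ε.ε₃ ^ 2 - ε.ε₁ * ε.ε₂) * ∑ i, ∑ j ∈ Finset.Ioi i, ξ (DefLie.l n ε i j) ^ 2)

/-- The special coadjoint orbit `𝒪₂ₙ(ε)`: the locus `C₂ = -2` in the cone of all `ξ` that satisfy
the Plücker relations between the coordinates `l_{ij}`, `x_i`, `p_i`, `I`. -/
def specialOrbit (n : ℕ) (ε : Params) : Set (DefLieDual n ε) :=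
  {ξ | casimir n ε ξ = -2 ∧
    (∀ i j, ξ (DefLie.I n ε) * ξ (DefLie.l n ε i j) =
      ξ (DefLie.x n ε i) * ξ (DefLie.p n ε j) - ξ (DefLie.x n ε j) * ξ (DefLie.p n ε i)) ∧
    (∀ i j k, ξ (DefLie.l n ε i j) * ξ (DefLie.x n ε k)
      - ξ (DefLie.l n ε i k) * ξ (DefLie.x n ε j)
      + ξ (DefLie.l n ε j k) * ξ (DefLie.x n ε i) = 0) ∧
    (∀ i j k, ξ (DefLie.l n ε i j) * ξ (DefLie.p n ε k)
      - ξ (DefLie.l n ε i k) * ξ (DefLie.p n ε j)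
      + ξ (DefLie.l n ε j k) * ξ (DefLie.p n ε i) = 0) ∧
    (∀ i j k m, ξ (DefLie.l n ε i j) * ξ (DefLie.l n ε k m) =
      ξ (DefLie.l n ε i k) * ξ (DefLie.l n ε j m)
        - ξ (DefLie.l n ε i m) * ξ (DefLie.l n ε j k))}

/-- The part `𝒪⁺₂ₙ(ε)` of the special orbit on which `I > 0`. -/
def specialOrbitPos (n : ℕ) (ε : Params) : Set (DefLieDual n ε) :=
  {ξ ∈ specialOrbit n ε | 0 < ξ (DefLie.I n ε)}

/-- The part `𝒪⁻₂ₙ(ε)` of the special orbit on which `I < 0`. -/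
def specialOrbitNeg (n : ℕ) (ε : Params) : Set (DefLieDual n ε) :=
  {ξ ∈ specialOrbit n ε | ξ (DefLie.I n ε) < 0}

/-- The infinitesimal coadjoint action, `(ad*_X ξ)(Y) = -ξ([X, Y])`. -/
def coad {n : ℕ} {ε : Params} (X : DefLie n ε) (ξ : DefLieDual n ε) : DefLieDual n ε :=
  LinearMap.toContinuousLinearMap (-(ξ.toLinearMap ∘ₗ (LieAlgebra.ad ℝ (DefLie n ε) X)))

theorem coad_apply {n : ℕ} {ε : Params} (X Y : DefLie n ε) (ξ : DefLieDual n ε) :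
    coad X ξ Y = -ξ ⁅X, Y⁆ := rfl

/-! ### Cotangent bundles and their standard symplectic form -/

/-- The exterior derivative at `z` of a `1`-form `θ` on a manifold without boundary, computed in
the preferred chart at `z`: `dθ(u, v) = D_u θ(v) - D_v θ(u)`. -/
def oneFormExtDeriv {E : Type*} [NormedAddCommGroup E] [NormedSpace ℝ E]
    {H : Type*} [TopologicalSpace H] (J : ModelWithCorners ℝ E H)
    {N : Type*} [TopologicalSpace N] [ChartedSpace H N]
    (θ : ∀ z : N, TangentSpace J z →L[ℝ] ℝ) (z : N) (u v : TangentSpace J z) : ℝ :=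
  let φ := extChartAt J z
  let θ' : E → (E →L[ℝ] ℝ) := fun y => (θ (φ.symm y)).comp (mfderiv 𝓘(ℝ, E) J φ.symm y)
  let u' : E := mfderiv J 𝓘(ℝ, E) φ z u
  let v' : E := mfderiv J 𝓘(ℝ, E) φ z v
  fderiv ℝ θ' (φ z) u' v' - fderiv ℝ θ' (φ z) v' u'

section Cotangent

variable (E : Type*) [NormedAddCommGroup E] [NormedSpace ℝ E]
  (M : Type*) [TopologicalSpace M] [ChartedSpace E M] [IsManifold 𝓘(ℝ, E) ∞ M]

/-- The cotangent bundle `T*M` of a smooth manifold `M` modelled on `E`, with Mathlib's topology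
and smooth structure on the dual of the tangent bundle. -/
abbrev CotangentBundle : Type _ :=
  TotalSpace (E →L[ℝ] ℝ) (fun q : M => TangentSpace 𝓘(ℝ, E) q →L[ℝ] ℝ)

/-- The model of `T*M`. -/
abbrev cotangentModel : ModelWithCorners ℝ (E × (E →L[ℝ] ℝ)) (ModelProd E (E →L[ℝ] ℝ)) :=
  𝓘(ℝ, E).prod 𝓘(ℝ, E →L[ℝ] ℝ)

/-- The tautological (Liouville) form `θ = p dq` on `T*M`: at a covector `z`, it sends `u` to
`z (dπ u)`, where `π : T*M → M` is the projection. -/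
def tautologicalForm (z : CotangentBundle E M) : TangentSpace (cotangentModel E) z →L[ℝ] ℝ :=
  z.2.comp (mfderiv (cotangentModel E) 𝓘(ℝ, E) (TotalSpace.proj : CotangentBundle E M → M) z)

/-- The standard symplectic form `ω = -dθ` (`= ∑ dqᵢ ∧ dpᵢ` in coordinates) on `T*M`. -/
def cotangentForm (z : CotangentBundle E M) (u v : TangentSpace (cotangentModel E) z) : ℝ :=
  -oneFormExtDeriv (cotangentModel E) (tautologicalForm E M) z u v

variable {E M} in
/-- `Φ` is a symplectomorphism from `T*M` onto `S ⊆ 𝔤ₙ(ε)^∨`, where `S` carries the structure of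
an embedded submanifold and the Kirillov–Kostant–Souriau form. That is, `Φ` is a smooth embedding
with image `S`; the tangent spaces of `S` are those of coadjoint orbits,
`T_ξ S = {ad*_X ξ | X ∈ 𝔤ₙ(ε)}`; and the pull-back of the form
`ω_ξ(ad*_X ξ, ad*_Y ξ) = ξ([X, Y])` is the standard symplectic form of `T*M`. -/
structure IsSymplectomorphismOnto {n : ℕ} {ε : Params}
    (Φ : CotangentBundle E M → DefLieDual n ε) (S : Set (DefLieDual n ε)) : Prop where
  contMDiff : ContMDiff (cotangentModel E) 𝓘(ℝ, DefLieDual n ε) ∞ Φ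
  isEmbedding : IsEmbedding Φ
  injective_mfderiv :
    ∀ z, Function.Injective (mfderiv (cotangentModel E) 𝓘(ℝ, DefLieDual n ε) Φ z)
  range_eq : range Φ = S
  range_mfderiv : ∀ z, range (mfderiv (cotangentModel E) 𝓘(ℝ, DefLieDual n ε) Φ z) =
    range (fun X : DefLie n ε => coad X (Φ z))
  pullback_eq : ∀ (z : CotangentBundle E M) (u v : TangentSpace (cotangentModel E) z)
    (X Y : DefLie n ε),
    mfderiv (cotangentModel E) 𝓘(ℝ, DefLieDual n ε) Φ z u = coad X (Φ z) →
    mfderiv (cotangentModel E) 𝓘(ℝ, DefLieDual n ε) Φ z v = coad Y (Φ z) →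
    cotangentForm E M z u v = Φ z ⁅X, Y⁆

/-- `S ⊆ 𝔤ₙ(ε)^∨` with the Kirillov–Kostant–Souriau form is symplectomorphic to `T*M` with its
standard symplectic form. -/
def SymplectomorphicToCotangent {n : ℕ} {ε : Params} (S : Set (DefLieDual n ε)) : Prop :=
  ∃ Φ : CotangentBundle E M → DefLieDual n ε, IsSymplectomorphismOnto Φ S

end Cotangent

/-! ### Sphere and hyperbolic space -/

/-- The unit sphere `Sⁿ ⊆ ℝⁿ⁺¹`. -/
abbrev UnitSphere (n : ℕ) : Type := Metric.sphere (0 : EuclideanSpace ℝ (Fin (n + 1))) 1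

/-- Hyperbolic space `ℍⁿ` in the hyperboloid model: the sheet `t > 0` of `t² - |y|² = 1` in
`ℝ × ℝⁿ`. -/
def HyperbolicSpace (n : ℕ) : Type :=
  {v : ℝ × EuclideanSpace ℝ (Fin n) // 0 < v.1 ∧ v.1 ^ 2 - ‖v.2‖ ^ 2 = 1}

namespace HyperbolicSpace

variable {n : ℕ}

instance : TopologicalSpace (HyperbolicSpace n) :=
  inferInstanceAs (TopologicalSpace
    {v : ℝ × EuclideanSpace ℝ (Fin n) // 0 < v.1 ∧ v.1 ^ 2 - ‖v.2‖ ^ 2 = 1})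

/-- The global chart `(t, y) ↦ y`; its inverse `y ↦ (√(1 + |y|²), y)` exhibits `ℍⁿ` as the graph
of a smooth function, so that this chart defines the submanifold structure. -/
def homeo (n : ℕ) : HyperbolicSpace n ≃ₜ EuclideanSpace ℝ (Fin n) where
  toFun v := v.1.2
  invFun y := ⟨(√(1 + ‖y‖ ^ 2), y), by positivity, by
    simp only
    rw [Real.sq_sqrt (by positivity)]
    ring⟩
  left_inv v := by
    apply Subtype.ext
    apply Prod.ext
    · have h := v.2.2
      have h' : 1 + ‖v.1.2‖ ^ 2 = v.1.1 ^ 2 := by linarith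
      simp only [h']
      exact Real.sqrt_sq v.2.1.le
    · rfl
  right_inv _ := rfl
  continuous_toFun := continuous_snd.comp continuous_subtype_val
  continuous_invFun := by
    apply Continuous.subtype_mk
    fun_prop

instance : ChartedSpace (EuclideanSpace ℝ (Fin n)) (HyperbolicSpace n) :=
  (homeo n).toOpenPartialHomeomorph.singletonChartedSpace rfl

instance : IsManifold (𝓡 n) ∞ (HyperbolicSpace n) :=
  (homeo n).toOpenPartialHomeomorph.isManifold_singleton rfl

end HyperbolicSpace

end

/-! On the cone `ε = s (α², β², αβ)` with `s = ±1`, the form on `ℝⁿ⁺²` is degenerate: its radical is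
spanned by `r = β vₙ₊₁ - α vₙ₊₂`, and the quotient by `r` is Euclidean for `s = 1` and Lorentzian
for `s = -1`. Hence `𝔤ₙ(ε)` is a semidirect product of the rotations (or Lorentz transformations) of
`F = ℝ × ℝⁿ` with the abelian ideal of translations, spanned by `I` and the `β xᵢ - α pᵢ`.
Evaluating `ξ` on this ideal gives a point `q = (I, β x - α p)` of `F`. By `casimir_eq` the Casimir
equation says exactly that `q` lies on the quadric `t² + s |y|² = 1`, which is a sphere or a
two-sheeted hyperboloid.

Let `M` be the sphere or one sheet. The rotations act on `T*M` by cotangent lifts of linear vector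
fields `A X`, and the translations by fibrewise shifts with the differentials of linear functions `f
X`. The momentum map of this action, `Φ z X = z (A X q) + f X q`, is the symplectomorphism.

Two ingredients carry the proof. The general one works for any `AffineAction`. In a chart, `dΦ`
sends the Hamiltonian field of `X` to `ad*_X Φ`, and these fields span the tangent space; this
yields the tangent spaces of the image and the pull-back of the Kirillov–Kostant–Souriau form. The
base point and the covector are continuous functions of `Φ z`, so `Φ` is an embedding
(`isEmbedding_momentum`, `isSymplectomorphismOnto`). The specific ingredient identifies the image
(`eq_ambientMomentum`): modulo translations, `ξ` is a bivector `J` on `F`; the Plücker relations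
give `q ∧ J = 0`, and since `q` has norm `1`, `J = q ∧ P` with `P` the contraction of `J` with `q`.

For `s = -1` the equation `t² = 1 + |y|²` keeps `I = t` away from zero, and each sheet gives a
connected piece. -/

noncomputable section

/-! ### Affine actions and their momentum maps in local coordinates. -/

/-- A linear representation `A` of `𝔤ₙ(ε)` on `F` together with a cocycle `f` with values in the
linear functions on `F`, such that a section `T` of `f` takes values in the kernel of `A`. This is
the data of an action of `𝔤ₙ(ε)` on `T*F` by lifts of linear vector fields and fibrewise
translations. -/
structure AffineAction (n : ℕ) (ε : Params) (F : Type*) [NormedAddCommGroup F]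
    [NormedSpace ℝ F] where
  A : DefLie n ε →ₗ[ℝ] F →L[ℝ] F
  f : DefLie n ε →ₗ[ℝ] F →L[ℝ] ℝ
  A_lie : ∀ X Y v, A ⁅X, Y⁆ v = A X (A Y v) - A Y (A X v)
  f_lie : ∀ X Y v, f ⁅X, Y⁆ v = f X (A Y v) - f Y (A X v)
  T : (F →L[ℝ] ℝ) → DefLie n ε
  A_T : ∀ φ, A (T φ) = 0
  f_T : ∀ φ, f (T φ) = φ
  /-- The projection of the dual space that is adjoint to `T`. -/
  P : DefLieDual n ε →L[ℝ] F
  P_apply : ∀ (ξ : DefLieDual n ε) (φ : F →L[ℝ] ℝ), φ (P ξ) = ξ (T φ)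
  /-- `R q v` is an element of the kernel of `f` that moves `q` in the direction `v`, if
  possible. -/
  R : F →L[ℝ] F →L[ℝ] DefLie n ε
  f_R : ∀ q v, f (R q v) = 0

/-- A local parametrization `σ` of an `A`-invariant submanifold of `F`, with the coordinate
expressions `V X` of the vector fields that `A X` induces on it. -/
structure AffineAction.LocalParam {n : ℕ} {ε : Params} {F : Type*} [NormedAddCommGroup F]
    [NormedSpace ℝ F] (a : AffineAction n ε F) {E : Type*} [NormedAddCommGroup E]
    [NormedSpace ℝ E] (U : Set E) (σ : E → F) (V : DefLie n ε →ₗ[ℝ] E → E) : Prop where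
  isOpen : IsOpen U
  contDiffOn : ContDiffOn ℝ ∞ σ U
  injective : ∀ u ∈ U, Function.Injective (fderiv ℝ σ u)
  fderiv_apply : ∀ X, ∀ u ∈ U, fderiv ℝ σ u (V X u) = a.A X (σ u)
  surjective : ∀ u ∈ U, ∀ e, ∃ X, V X u = e

/-- The momentum map in local coordinates. -/
def localMomentum {n : ℕ} {ε : Params} {F : Type*} [NormedAddCommGroup F]
    [NormedSpace ℝ F] (a : AffineAction n ε F) {E : Type*} [NormedAddCommGroup E]
    [NormedSpace ℝ E] (σ : E → F) (V : DefLie n ε →ₗ[ℝ] E → E) (y : E × (E →L[ℝ] ℝ)) :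
    DefLieDual n ε :=
  LinearMap.toContinuousLinearMap
    { toFun := fun X => y.2 (V X y.1) + a.f X (σ y.1)
      map_add' := fun X Y => by simp only [map_add, Pi.add_apply, add_apply]; ring
      map_smul' := fun c X => by
        simp only [map_smul, Pi.smul_apply, smul_apply, smul_eq_mul,
          RingHom.id_apply]
        ring }

namespace AffineAction.LocalParam

variable {n : ℕ} {ε : Params} {F : Type*} [NormedAddCommGroup F] [NormedSpace ℝ F]
  {a : AffineAction n ε F} {E : Type*} [NormedAddCommGroup E]
  [NormedSpace ℝ E] {U : Set E} {σ : E → F} {V : DefLie n ε →ₗ[ℝ] E → E}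

theorem localMomentum_apply (y : E × (E →L[ℝ] ℝ)) (X : DefLie n ε) :
    localMomentum a σ V y X = y.2 (V X y.1) + a.f X (σ y.1) := rfl

theorem contDiffAt (h : a.LocalParam U σ V) {u : E} (hu : u ∈ U) : ContDiffAt ℝ ∞ σ u :=
  h.contDiffOn.contDiffAt (h.isOpen.mem_nhds hu)

theorem contDiffAt_fderiv (h : a.LocalParam U σ V) {u : E} (hu : u ∈ U) :
    ContDiffAt ℝ ∞ (fderiv ℝ σ) u :=
  (h.contDiffAt hu).fderiv_right (m := ∞) (by simp)

variable [FiniteDimensional ℝ E] [FiniteDimensional ℝ F]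

/-- The field is prescribed only pointwise, by `dσ (V X) = A X σ`. A fixed left inverse `K'` of `dσ`
at `u` makes `K' ∘ dσ` invertible near `u`, so `V X` is the smooth function `(K' ∘ dσ)⁻¹ (K' (A X
σ))` there. -/
theorem contDiffAt_field (h : a.LocalParam U σ V) {u : E} (hu : u ∈ U) (X : DefLie n ε) :
    ContDiffAt ℝ ∞ (V X) u := by
  obtain ⟨K, hK⟩ := LinearMap.exists_leftInverse_of_injective (fderiv ℝ σ u : E →ₗ[ℝ] F)
    (LinearMap.ker_eq_bot.2 (h.injective u hu))
  set K' : F →L[ℝ] E := LinearMap.toContinuousLinearMap K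
  have hK' : K'.comp (fderiv ℝ σ u) = ContinuousLinearMap.id ℝ E := by
    ext e; exact congrArg (fun L : E →ₗ[ℝ] E => L e) hK
  have hW : ContDiffAt ℝ ∞ (fun w => K'.comp (fderiv ℝ σ w)) u :=
    contDiffAt_const.clm_comp (h.contDiffAt_fderiv hu)
  have hinv : ContDiffAt ℝ ∞ (fun w => (K'.comp (fderiv ℝ σ w)).inverse) u := by
    have h1 : ContDiffAt ℝ ∞ (ContinuousLinearMap.inverse : (E →L[ℝ] E) → (E →L[ℝ] E))
        (K'.comp (fderiv ℝ σ u)) := by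
      rw [hK']; exact contDiffAt_map_inverse (ContinuousLinearEquiv.refl ℝ E)
    exact h1.comp u hW
  have hs : ContDiffAt ℝ ∞
      (fun w => (K'.comp (fderiv ℝ σ w)).inverse (K' (a.A X (σ w)))) u :=
    hinv.clm_apply (K'.contDiff.contDiffAt.comp u
      ((a.A X).contDiff.contDiffAt.comp u (h.contDiffAt hu)))
  refine hs.congr_of_eventuallyEq ?_
  -- Invertible operators are open, and `K' ∘ dσ` is the identity at `u`.
  have hev : ∀ᶠ w in 𝓝 u, K'.comp (fderiv ℝ σ w) ∈
      Set.range ((↑) : (E ≃L[ℝ] E) → (E →L[ℝ] E)) := by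
    apply hW.continuousAt
    have := ContinuousLinearEquiv.nhds (ContinuousLinearEquiv.refl ℝ E)
    show _ ∈ 𝓝 (K'.comp (fderiv ℝ σ u))
    rw [hK']; exact this
  filter_upwards [hev, h.isOpen.mem_nhds hu] with w ⟨e, he⟩ hw
  have he_apply : K' (fderiv ℝ σ w (V X w)) = e (V X w) :=
    (congrArg (fun L : E →L[ℝ] E => L (V X w)) he).symm
  rw [← h.fderiv_apply X w hw, ← he,
    ContinuousLinearMap.inverse_equiv, he_apply]
  simp

theorem contDiffAt_localMomentum (h : a.LocalParam U σ V) {y : E × (E →L[ℝ] ℝ)}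
    (hy : y.1 ∈ U) : ContDiffAt ℝ ∞ (localMomentum a σ V) y := by
  have hopen : IsOpen (U ×ˢ (univ : Set (E →L[ℝ] ℝ))) := h.isOpen.prod isOpen_univ
  refine ContDiffOn.contDiffAt (s := U ×ˢ univ) ?_ (hopen.mem_nhds ⟨hy, mem_univ _⟩)
  -- The Lie algebra is finite-dimensional, so smoothness may be tested after evaluation at each
  -- `X`.
  rw [contDiffOn_clm_apply]
  intro X y hy
  simp only [localMomentum_apply]
  exact ((contDiffAt_snd.clm_apply ((h.contDiffAt_field hy.1 X).comp y contDiffAt_fst)).add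
    ((a.f X).contDiff.contDiffAt.comp y
      ((h.contDiffAt hy.1).comp y contDiffAt_fst))).contDiffWithinAt

theorem fderiv_localMomentum (h : a.LocalParam U σ V) {y : E × (E →L[ℝ] ℝ)}
    (hy : y.1 ∈ U) (w : E × (E →L[ℝ] ℝ)) (X : DefLie n ε) :
    fderiv ℝ (localMomentum a σ V) y w X =
      w.2 (V X y.1) + y.2 (fderiv ℝ (V X) y.1 w.1) + a.f X (fderiv ℝ σ y.1 w.1) := by
  have h1 : HasFDerivAt (localMomentum a σ V) (fderiv ℝ (localMomentum a σ V) y) y :=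
    ((h.contDiffAt_localMomentum hy).differentiableAt (by simp)).hasFDerivAt
  have h2 := ((ContinuousLinearMap.apply ℝ ℝ X).hasFDerivAt).comp y h1
  have hV : HasFDerivAt (V X) (fderiv ℝ (V X) y.1) y.1 :=
    ((h.contDiffAt_field hy X).differentiableAt (by simp)).hasFDerivAt
  have hs : HasFDerivAt σ (fderiv ℝ σ y.1) y.1 :=
    ((h.contDiffAt hy).differentiableAt (by simp)).hasFDerivAt
  have h3 := ((hasFDerivAt_snd (p := y) (𝕜 := ℝ)).clm_apply
    (hV.comp y hasFDerivAt_fst)).add ((a.f X).hasFDerivAt.comp y (hs.comp y hasFDerivAt_fst))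
  have h4 := h2.unique h3
  have := congrArg (fun L : (E × (E →L[ℝ] ℝ)) →L[ℝ] ℝ => L w) h4
  simp at this
  rw [this]; ring

/-- Differentiating `dσ (V X) = A X σ` along `V Y` and antisymmetrizing, the second derivatives of
`σ` cancel by symmetry and the commutator relation `A_lie` remains. The sign is opposite to the
usual bracket of vector fields. -/
theorem field_lie (h : a.LocalParam U σ V) {u : E} (hu : u ∈ U) (X Y : DefLie n ε) :
    V ⁅X, Y⁆ u = fderiv ℝ (V X) u (V Y u) - fderiv ℝ (V Y) u (V X u) := by
  have key : ∀ (Z : DefLie n ε) (e : E),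
      fderiv ℝ (fderiv ℝ σ) u e (V Z u) + fderiv ℝ σ u (fderiv ℝ (V Z) u e) =
        a.A Z (fderiv ℝ σ u e) := by
    intro Z e
    have hV : HasFDerivAt (V Z) (fderiv ℝ (V Z) u) u :=
      ((h.contDiffAt_field hu Z).differentiableAt (by simp)).hasFDerivAt
    have hs : HasFDerivAt σ (fderiv ℝ σ u) u :=
      ((h.contDiffAt hu).differentiableAt (by simp)).hasFDerivAt
    have hd : HasFDerivAt (fderiv ℝ σ) (fderiv ℝ (fderiv ℝ σ) u) u :=
      ((h.contDiffAt_fderiv hu).differentiableAt (by simp)).hasFDerivAt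
    have h1 := hd.clm_apply hV
    have h2 := (a.A Z).hasFDerivAt.comp u hs
    have h3 := h1.congr_of_eventuallyEq (f₁ := fun w => a.A Z (σ w))
      (by filter_upwards [h.isOpen.mem_nhds hu] with w hw using (h.fderiv_apply Z w hw).symm)
    have h4 := congrArg (fun L : E →L[ℝ] F => L e) (h3.unique h2)
    simp at h4
    rw [← h4, add_comm]
  have symm : fderiv ℝ (fderiv ℝ σ) u (V X u) (V Y u) =
      fderiv ℝ (fderiv ℝ σ) u (V Y u) (V X u) :=
    (ContDiffAt.isSymmSndFDerivAt (h.contDiffAt hu) (by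
      simpa using (WithTop.coe_le_coe.2 le_top : ((2 : ℕ∞) : ℕ∞ω) ≤ ((⊤ : ℕ∞) : ℕ∞ω)))).eq _ _
  apply h.injective u hu
  rw [h.fderiv_apply _ u hu, a.A_lie, map_sub, ← h.fderiv_apply Y u hu, ← h.fderiv_apply X u hu,
    ← key, ← key, symm]
  abel

/-- The Hamiltonian vector field of the `X`-component of the momentum map. -/
def hamiltonian (a : AffineAction n ε F) (σ : E → F) (V : DefLie n ε →ₗ[ℝ] E → E)
    (X : DefLie n ε) (y : E × (E →L[ℝ] ℝ)) : E × (E →L[ℝ] ℝ) :=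
  (V X y.1, -(y.2.comp (fderiv ℝ (V X) y.1)) - (a.f X).comp (fderiv ℝ σ y.1))

/-- Hamilton's equation `dΦ_X = ω(H_X, ·)` for `ω(w, w') = w'.2 w.1 - w.2 w'.1`. -/
theorem fderiv_localMomentum_eq_form (h : a.LocalParam U σ V) {y : E × (E →L[ℝ] ℝ)}
    (hy : y.1 ∈ U) (w : E × (E →L[ℝ] ℝ)) (X : DefLie n ε) :
    fderiv ℝ (localMomentum a σ V) y w X =
      w.2 (hamiltonian a σ V X y).1 - (hamiltonian a σ V X y).2 w.1 := by
  rw [h.fderiv_localMomentum hy]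
  simp [hamiltonian]
  ring

/-- Infinitesimal equivariance of the momentum map. The linear part comes from `field_lie`, the
inhomogeneous part from the cocycle identity `f_lie`. -/
theorem fderiv_localMomentum_hamiltonian (h : a.LocalParam U σ V) {y : E × (E →L[ℝ] ℝ)}
    (hy : y.1 ∈ U) (X : DefLie n ε) :
    fderiv ℝ (localMomentum a σ V) y (hamiltonian a σ V X y) =
      coad X (localMomentum a σ V y) := by
  ext Y
  rw [h.fderiv_localMomentum hy, coad_apply, localMomentum_apply, h.field_lie hy, a.f_lie]
  simp [hamiltonian, h.fderiv_apply _ _ hy]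
  ring

/-- The translations `T φ` have zero field, so testing on them leaves `φ (dσ w.1) = 0` for every
`φ`, whence `w.1 = 0`. Testing on the remaining `X` then kills `w.2`, because the fields span. -/
theorem injective_fderiv_localMomentum (h : a.LocalParam U σ V) {y : E × (E →L[ℝ] ℝ)}
    (hy : y.1 ∈ U) : Function.Injective (fderiv ℝ (localMomentum a σ V) y) := by
  rw [injective_iff_map_eq_zero]
  intro w hw
  have hX : ∀ X, fderiv ℝ (localMomentum a σ V) y w X = 0 := by simp [hw]
  have h1 : w.1 = 0 := by
    apply h.injective _ hy
    rw [map_zero]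
    by_contra hne
    obtain ⟨φ, hφ⟩ := SeparatingDual.exists_ne_zero (R := ℝ) hne
    apply hφ
    have hT := hX (a.T φ)
    have hVT : ∀ u ∈ U, V (a.T φ) u = 0 := fun u hu => h.injective u hu (by
      rw [h.fderiv_apply _ _ hu, a.A_T]; simp)
    have hd : fderiv ℝ (V (a.T φ)) y.1 = 0 := by
      have : V (a.T φ) =ᶠ[𝓝 y.1] fun _ => 0 := by
        filter_upwards [h.isOpen.mem_nhds hy] with u hu using hVT u hu
      rw [this.fderiv_eq]; simp
    rw [h.fderiv_localMomentum hy, hVT _ hy, hd, a.f_T] at hT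
    simpa using hT
  refine Prod.ext h1 ?_
  ext e
  obtain ⟨X, rfl⟩ := h.surjective _ hy e
  have := hX X
  rw [h.fderiv_localMomentum hy, h1] at this
  simpa using this

omit [FiniteDimensional ℝ E] in
-- Transitivity on the base supplies the first component; adding a translation `T φ` leaves it
-- unchanged and shifts the covector by `-φ ∘ dσ`, which is arbitrary because `dσ` is injective.
theorem surjective_hamiltonian (h : a.LocalParam U σ V) {y : E × (E →L[ℝ] ℝ)}
    (hy : y.1 ∈ U) (w : E × (E →L[ℝ] ℝ)) : ∃ X, hamiltonian a σ V X y = w := by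
  obtain ⟨X, hX⟩ := h.surjective _ hy w.1
  obtain ⟨K, hK⟩ := LinearMap.exists_leftInverse_of_injective (fderiv ℝ σ y.1 : E →ₗ[ℝ] F)
    (LinearMap.ker_eq_bot.2 (h.injective y.1 hy))
  have hK' : ∀ e, K (fderiv ℝ σ y.1 e) = e := fun e => congrArg (fun L : E →ₗ[ℝ] E => L e) hK
  -- The missing covector on `E` is extended to `F` through the left inverse `K` of `dσ`.
  set φ : F →L[ℝ] ℝ :=
    ((hamiltonian a σ V X y).2 - w.2).comp (LinearMap.toContinuousLinearMap K) with hφ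
  have hVT : ∀ u ∈ U, V (a.T φ) u = 0 := fun u hu => h.injective u hu (by
      rw [h.fderiv_apply _ _ hu, a.A_T]; simp)
  have hd : V (a.T φ) =ᶠ[𝓝 y.1] fun _ => 0 := by
    filter_upwards [h.isOpen.mem_nhds hy] with u hu using hVT u hu
  have hadd : fderiv ℝ (V (X + a.T φ)) y.1 = fderiv ℝ (V X) y.1 := by
    apply Filter.EventuallyEq.fderiv_eq
    filter_upwards [hd] with u hu
    simp [hu]
  refine ⟨X + a.T φ, Prod.ext ?_ ?_⟩
  · simp [hamiltonian, hVT _ hy, hX]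
  · ext e
    have h1 : φ (fderiv ℝ σ y.1 e) = (hamiltonian a σ V X y).2 e - w.2 e := by
      simp [hφ, hK']
    simp only [hamiltonian] at h1 ⊢
    rw [hadd, map_add, a.f_T]
    simp [h1]
    ring

theorem range_fderiv_localMomentum (h : a.LocalParam U σ V) {y : E × (E →L[ℝ] ℝ)}
    (hy : y.1 ∈ U) : range (fderiv ℝ (localMomentum a σ V) y) =
      range (fun X : DefLie n ε => coad X (localMomentum a σ V y)) := by
  apply Subset.antisymm
  · rintro _ ⟨w, rfl⟩
    obtain ⟨X, rfl⟩ := h.surjective_hamiltonian hy w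
    exact ⟨X, (h.fderiv_localMomentum_hamiltonian hy X).symm⟩
  · rintro _ ⟨X, rfl⟩
    exact ⟨_, h.fderiv_localMomentum_hamiltonian hy X⟩

/-- By injectivity `w₁` is the Hamiltonian vector of `X`, so the left side is `dΦ_X(w₂) = (ad*_Y
Φ)(X) = Φ [X, Y]`. -/
theorem form_eq_of_fderiv_eq_coad (h : a.LocalParam U σ V) {y w₁ w₂ : E × (E →L[ℝ] ℝ)}
    (hy : y.1 ∈ U) {X Y : DefLie n ε}
    (h₁ : fderiv ℝ (localMomentum a σ V) y w₁ = coad X (localMomentum a σ V y))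
    (h₂ : fderiv ℝ (localMomentum a σ V) y w₂ = coad Y (localMomentum a σ V y)) :
    w₂.2 w₁.1 - w₁.2 w₂.1 = localMomentum a σ V y ⁅X, Y⁆ := by
  have e₁ : w₁ = hamiltonian a σ V X y := h.injective_fderiv_localMomentum hy
    (h₁.trans (h.fderiv_localMomentum_hamiltonian hy X).symm)
  rw [e₁, ← h.fderiv_localMomentum_eq_form hy, h₂, coad_apply, ← lie_skew, map_neg, neg_neg]

end AffineAction.LocalParam

/-! ### Charts of cotangent bundles -/

section CotangentCharts

variable {E : Type*} [NormedAddCommGroup E] [NormedSpace ℝ E]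
  {M : Type*} [TopologicalSpace M] [ChartedSpace E M] [IsManifold 𝓘(ℝ, E) ∞ M]

/-- The derivative of the preferred chart at `q₀`, as an endomorphism of the model space. -/
def chartDeriv (E : Type*) [NormedAddCommGroup E] [NormedSpace ℝ E]
    {M : Type*} [TopologicalSpace M] [ChartedSpace E M] (q₀ q : M) : E →L[ℝ] E :=
  mfderiv 𝓘(ℝ, E) 𝓘(ℝ, E) (extChartAt 𝓘(ℝ, E) q₀) q

/-- The derivative of the inverse of the preferred chart at `q₀`, as an endomorphism of the model
space. -/
def chartSymmDeriv {E : Type*} [NormedAddCommGroup E] [NormedSpace ℝ E]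
    {M : Type*} [TopologicalSpace M] [ChartedSpace E M] (q₀ : M) (u : E) : E →L[ℝ] E :=
  mfderiv 𝓘(ℝ, E) 𝓘(ℝ, E) (extChartAt 𝓘(ℝ, E) q₀).symm u

theorem chartDeriv_chartSymmDeriv {q₀ : M} {u : E} (hu : u ∈ (extChartAt 𝓘(ℝ, E) q₀).target)
    (e : E) : chartDeriv E q₀ ((extChartAt 𝓘(ℝ, E) q₀).symm u) (chartSymmDeriv q₀ u e) = e := by
  have : IsManifold 𝓘(ℝ, E) 1 M := IsManifold.of_le (n := ∞) (by simp)
  have h := mfderiv_extChartAt_comp_mfderivWithin_extChartAt_symm (I := 𝓘(ℝ, E)) hu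
  rw [modelWithCornersSelf_coe, range_id, mfderivWithin_univ] at h
  exact congrArg (fun L : E →L[ℝ] E => L e) h

theorem chartSymmDeriv_chartDeriv {q₀ : M} {u : E} (hu : u ∈ (extChartAt 𝓘(ℝ, E) q₀).target)
    (e : E) : chartSymmDeriv q₀ u (chartDeriv E q₀ ((extChartAt 𝓘(ℝ, E) q₀).symm u) e) = e := by
  have : IsManifold 𝓘(ℝ, E) 1 M := IsManifold.of_le (n := ∞) (by simp)
  have h := mfderivWithin_extChartAt_symm_comp_mfderiv_extChartAt (I := 𝓘(ℝ, E)) hu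
  rw [modelWithCornersSelf_coe, range_id, mfderivWithin_univ] at h
  exact congrArg (fun L : E →L[ℝ] E => L e) h

theorem cotangent_extChartAt_source (z₀ : CotangentBundle E M) :
    (extChartAt (cotangentModel E) z₀).source =
      TotalSpace.proj ⁻¹' (extChartAt 𝓘(ℝ, E) z₀.proj).source := by
  rw [FiberBundle.extChartAt]
  ext z
  simp only [PartialEquiv.trans_source, PartialEquiv.prod_source, mem_inter_iff, mem_preimage,
    hom_trivializationAt_source, TangentBundle.trivializationAt_baseSet, extChartAt_source]
  exact ⟨fun h => h.1.1, fun h => ⟨⟨h, mem_univ _⟩, h, mem_univ _⟩⟩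

theorem cotangent_extChartAt_target (z₀ : CotangentBundle E M) :
    (extChartAt (cotangentModel E) z₀).target =
      (extChartAt 𝓘(ℝ, E) z₀.proj).target ×ˢ univ := by
  rw [FiberBundle.extChartAt_target, hom_trivializationAt_baseSet,
    TangentBundle.trivializationAt_baseSet]
  congr 1
  refine inter_eq_left.2 fun u hu => ⟨?_, mem_univ _⟩
  have := (extChartAt 𝓘(ℝ, E) z₀.proj).map_target hu
  rwa [extChartAt_source] at this

/-- This makes the bundle charts the classical ones: the fibre coordinate of a covector is its
pull-back along the inverse chart of the base. -/
theorem cotangent_extChartAt_snd {z₀ z : CotangentBundle E M}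
    (hz : z.proj ∈ (extChartAt 𝓘(ℝ, E) z₀.proj).source) (e : E) :
    (extChartAt (cotangentModel E) z₀ z).2 e =
      z.2 (chartSymmDeriv z₀.proj (extChartAt 𝓘(ℝ, E) z₀.proj z.proj) e) := by
  have : IsManifold 𝓘(ℝ, E) 1 M := IsManifold.of_le (n := ∞) (by simp)
  rw [extChartAt_source] at hz
  have h := TangentBundle.symmL_trivializationAt (I := 𝓘(ℝ, E)) hz
  rw [modelWithCornersSelf_coe, range_id, mfderivWithin_univ] at h
  rw [chartSymmDeriv, ← h]
  have h' : (extChartAt (cotangentModel E) z₀ z).2 e =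
    (trivializationAt ℝ (Bundle.Trivial M ℝ) z₀.proj).continuousLinearMapAt ℝ z.proj
      (z.2 ((trivializationAt E (TangentSpace 𝓘(ℝ, E)) z₀.proj).symmL ℝ z.proj e)) := rfl
  rw [h']
  change (Bundle.Trivial.trivialization M ℝ).continuousLinearMapAt ℝ z.proj _ = _
  rw [Bundle.Trivial.continuousLinearMapAt_trivialization]
  rfl

theorem cotangent_extChartAt_symm (z₀ : CotangentBundle E M) {y : E × (E →L[ℝ] ℝ)}
    (hy : y.1 ∈ (extChartAt 𝓘(ℝ, E) z₀.proj).target) :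
    (extChartAt (cotangentModel E) z₀).symm y =
      ⟨(extChartAt 𝓘(ℝ, E) z₀.proj).symm y.1,
        y.2.comp (chartDeriv E z₀.proj ((extChartAt 𝓘(ℝ, E) z₀.proj).symm y.1))⟩ := by
  set z : CotangentBundle E M := ⟨(extChartAt 𝓘(ℝ, E) z₀.proj).symm y.1,
        y.2.comp (chartDeriv E z₀.proj ((extChartAt 𝓘(ℝ, E) z₀.proj).symm y.1))⟩ with hz
  have hzs : z.proj ∈ (extChartAt 𝓘(ℝ, E) z₀.proj).source :=
    (extChartAt 𝓘(ℝ, E) z₀.proj).map_target hy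
  have h1 : extChartAt 𝓘(ℝ, E) z₀.proj z.proj = y.1 :=
    (extChartAt 𝓘(ℝ, E) z₀.proj).right_inv hy
  have h2 : extChartAt (cotangentModel E) z₀ z = y := by
    refine Prod.ext h1 ?_
    ext e
    rw [cotangent_extChartAt_snd hzs, h1]
    exact congrArg y.2 (chartDeriv_chartSymmDeriv hy e)
  rw [← h2]
  apply (extChartAt (cotangentModel E) z₀).left_inv
  rw [cotangent_extChartAt_source]
  exact hzs

theorem contMDiffOn_cotangent_extChartAt_symm (z₀ : CotangentBundle E M) :
    ContMDiffOn 𝓘(ℝ, E × (E →L[ℝ] ℝ)) (cotangentModel E) ∞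
      (extChartAt (cotangentModel E) z₀).symm (extChartAt (cotangentModel E) z₀).target :=
  contMDiffOn_extChartAt_symm z₀

set_option synthInstance.maxHeartbeats 200000 in
/-- The standard symplectic form in the coordinates `(u, π)` of a cotangent chart. -/
theorem cotangentForm_eq (z : CotangentBundle E M)
    (w₁ w₂ : TangentSpace (cotangentModel E) z) :
    let φ : TangentSpace (cotangentModel E) z →L[ℝ] E × (E →L[ℝ] ℝ) :=
      mfderiv (cotangentModel E) 𝓘(ℝ, E × (E →L[ℝ] ℝ)) (extChartAt (cotangentModel E) z) z
    cotangentForm E M z w₁ w₂ = (φ w₂).2 (φ w₁).1 - (φ w₁).2 (φ w₂).1 := by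
  intro φ
  set c := extChartAt (cotangentModel E) z with hc
  set c₀ := extChartAt 𝓘(ℝ, E) z.proj with hc₀
  -- `L y` is the form `w ↦ y.2 w.1`, that is `π du`. It is linear in `y`, so the tautological form
  -- is its own derivative in these coordinates.
  let L : (E × (E →L[ℝ] ℝ)) →L[ℝ] (E × (E →L[ℝ] ℝ)) →L[ℝ] ℝ :=
    ((ContinuousLinearMap.compL ℝ (E × (E →L[ℝ] ℝ)) E ℝ).flip (ContinuousLinearMap.fst ℝ E _)).comp
      (ContinuousLinearMap.snd ℝ E (E →L[ℝ] ℝ))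
  let θ' : E × (E →L[ℝ] ℝ) → ((E × (E →L[ℝ] ℝ)) →L[ℝ] ℝ) := fun y =>
    (tautologicalForm E M (c.symm y)).comp
      (mfderiv 𝓘(ℝ, E × (E →L[ℝ] ℝ)) (cotangentModel E) c.symm y)
  have hopen : IsOpen (c₀.target ×ˢ (univ : Set (E →L[ℝ] ℝ))) :=
    (isOpen_extChartAt_target z.proj).prod isOpen_univ
  have hθ : ∀ y ∈ c₀.target ×ˢ (univ : Set (E →L[ℝ] ℝ)), θ' y = L y := by
    intro y hy
    have hc_diff : MDifferentiableAt 𝓘(ℝ, E × (E →L[ℝ] ℝ)) (cotangentModel E) c.symm y := by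
      have h := contMDiffOn_cotangent_extChartAt_symm z
      rw [cotangent_extChartAt_target] at h
      exact ((h y hy).contMDiffAt (hopen.mem_nhds hy)).mdifferentiableAt (by simp)
    have hproj : MDifferentiableAt (cotangentModel E) 𝓘(ℝ, E)
        (TotalSpace.proj : CotangentBundle E M → M) (c.symm y) :=
      (Bundle.contMDiff_proj _ (n := ∞)).mdifferentiableAt (by simp)
    have hc₀_diff : MDifferentiableAt 𝓘(ℝ, E) 𝓘(ℝ, E) c₀.symm y.1 :=
      ((contMDiffOn_extChartAt_symm (n := ∞) z.proj y.1 hy.1).contMDiffAt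
        ((isOpen_extChartAt_target z.proj).mem_nhds hy.1)).mdifferentiableAt (by simp)
    have hfst : MDifferentiableAt 𝓘(ℝ, E × (E →L[ℝ] ℝ)) 𝓘(ℝ, E)
        (Prod.fst : E × (E →L[ℝ] ℝ) → E) y := mdifferentiableAt_iff_differentiableAt.2
          differentiableAt_fst
    have hcomp : (mfderiv (cotangentModel E) 𝓘(ℝ, E)
        (TotalSpace.proj : CotangentBundle E M → M) (c.symm y)).comp
        (mfderiv 𝓘(ℝ, E × (E →L[ℝ] ℝ)) (cotangentModel E) c.symm y) =
        (mfderiv 𝓘(ℝ, E) 𝓘(ℝ, E) c₀.symm y.1).comp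
          (mfderiv 𝓘(ℝ, E × (E →L[ℝ] ℝ)) 𝓘(ℝ, E) Prod.fst y) := by
      rw [← mfderiv_comp _ hproj hc_diff, ← mfderiv_comp _ hc₀_diff hfst]
      apply Filter.EventuallyEq.mfderiv_eq
      filter_upwards [hopen.mem_nhds hy] with y' hy'
      simp only [Function.comp_apply]
      rw [hc, cotangent_extChartAt_symm z hy'.1]
    -- Stated for a variable `z'` because the type of `z'.2` depends on the base point; substitution
    -- then replaces a dependent rewrite.
    have hz : ∀ z' : CotangentBundle E M, z' = ⟨c₀.symm y.1,
        y.2.comp (chartDeriv E z.proj (c₀.symm y.1))⟩ → ∀ e : E,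
        (show E →L[ℝ] ℝ from z'.2) (chartSymmDeriv z.proj y.1 e) = y.2 e := by
      rintro _ rfl e
      exact congrArg y.2 (chartDeriv_chartSymmDeriv hy.1 e)
    refine ContinuousLinearMap.ext fun w => ?_
    have h1 := hz _ (cotangent_extChartAt_symm z hy.1) w.1
    have h2 : (mfderiv (cotangentModel E) 𝓘(ℝ, E)
        (TotalSpace.proj : CotangentBundle E M → M) (c.symm y))
        (mfderiv 𝓘(ℝ, E × (E →L[ℝ] ℝ)) (cotangentModel E) c.symm y w) =
        chartSymmDeriv z.proj y.1 w.1 := by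
      have h3 := congrArg (fun L : E × (E →L[ℝ] ℝ) →L[ℝ] E => L w) hcomp
      have h4 : mfderiv 𝓘(ℝ, E × (E →L[ℝ] ℝ)) 𝓘(ℝ, E) (Prod.fst : E × (E →L[ℝ] ℝ) → E) y =
          ContinuousLinearMap.fst ℝ E (E →L[ℝ] ℝ) := by
        rw [mfderiv_eq_fderiv, fderiv_fst]
      rw [h4] at h3
      exact h3
    exact (congrArg (show E →L[ℝ] ℝ from (c.symm y).2) h2).trans h1
  have hmem : c z ∈ c₀.target ×ˢ (univ : Set (E →L[ℝ] ℝ)) :=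
    ⟨mem_extChartAt_target z.proj, mem_univ _⟩
  have hfd : fderiv ℝ θ' (c z) = L := by
    have : θ' =ᶠ[𝓝 (c z)] L := by
      filter_upwards [hopen.mem_nhds hmem] with y hy using hθ y hy
    rw [this.fderiv_eq]
    exact ContinuousLinearMap.fderiv (𝕜 := ℝ) (E := E × (E →L[ℝ] ℝ))
      (F := (E × (E →L[ℝ] ℝ)) →L[ℝ] ℝ) L
  have : cotangentForm E M z w₁ w₂ =
    -(fderiv ℝ θ' (c z) (φ w₁) (φ w₂) - fderiv ℝ θ' (c z) (φ w₂) (φ w₁)) := rfl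
  rw [this, hfd]
  simp [L]

end CotangentCharts

/-! ### The momentum map of a cotangent bundle -/

section Momentum

variable {n : ℕ} {ε : Params} {F : Type*} [NormedAddCommGroup F] [NormedSpace ℝ F]
  {E : Type*} [NormedAddCommGroup E] [NormedSpace ℝ E]
  {M : Type*} [TopologicalSpace M] [ChartedSpace E M]

/-- A smoothly embedded submanifold `ι : M → F` whose tangent space at `q` consists of the vectors
`A X q`. -/
structure AffineAction.IsHomogeneous (a : AffineAction n ε F) (ι : M → F) : Prop where
  contMDiff : ContMDiff 𝓘(ℝ, E) 𝓘(ℝ, F) ∞ ι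
  isEmbedding : IsEmbedding ι
  injective : ∀ q, Function.Injective (mfderiv 𝓘(ℝ, E) 𝓘(ℝ, F) ι q)
  mem_range : ∀ X q, a.A X (ι q) ∈ range (mfderiv 𝓘(ℝ, E) 𝓘(ℝ, F) ι q)
  A_R : ∀ q, ∀ v ∈ range (mfderiv 𝓘(ℝ, E) 𝓘(ℝ, F) ι q), a.A (a.R (ι q) v) (ι q) = v

/-- The derivative of `ι : M → F`, as a map between the model spaces. -/
def modelDeriv (E : Type*) [NormedAddCommGroup E] [NormedSpace ℝ E]
    {M : Type*} [TopologicalSpace M] [ChartedSpace E M] (ι : M → F) (q : M) : E →L[ℝ] F :=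
  mfderiv 𝓘(ℝ, E) 𝓘(ℝ, F) ι q

/-- A left inverse of the derivative of an immersion `ι : M → F`. -/
def derivLeftInverse (E : Type*) [NormedAddCommGroup E] [NormedSpace ℝ E]
    {M : Type*} [TopologicalSpace M] [ChartedSpace E M] (ι : M → F) (q : M) : F →ₗ[ℝ] E :=
  (modelDeriv E ι q : E →ₗ[ℝ] F).leftInverse

variable [IsManifold 𝓘(ℝ, E) ∞ M]

/-- The covector `z.2`, as a linear form on the model space. -/
def covector (z : CotangentBundle E M) : E →L[ℝ] ℝ := z.2

/-- The momentum map of the action of `𝔤ₙ(ε)` on `T*M` by lifts of the vector fields `A X` and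
fibrewise translations by the differentials of the functions `f X`. -/
def momentum (a : AffineAction n ε F) (ι : M → F) (z : CotangentBundle E M) : DefLieDual n ε :=
  LinearMap.toContinuousLinearMap
    { toFun := fun X => covector z (derivLeftInverse E ι z.proj (a.A X (ι z.proj)))
        + a.f X (ι z.proj)
      map_add' := fun X Y => by simp only [map_add, add_apply]; ring
      map_smul' := fun c X => by
        simp only [map_smul, smul_apply, smul_eq_mul, RingHom.id_apply]
        ring }

/-- The vector field on `M` induced by `A X`, in the preferred chart at `q₀`. -/
def chartField (a : AffineAction n ε F) (ι : M → F) (q₀ : M) : DefLie n ε →ₗ[ℝ] E → E where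
  toFun X u := chartDeriv E q₀ ((extChartAt 𝓘(ℝ, E) q₀).symm u)
    (derivLeftInverse E ι ((extChartAt 𝓘(ℝ, E) q₀).symm u)
      (a.A X (ι ((extChartAt 𝓘(ℝ, E) q₀).symm u))))
  map_add' X Y := by ext u; simp
  map_smul' c X := by ext u; simp

omit [IsManifold 𝓘(ℝ, E) ∞ M] in
theorem momentum_apply (a : AffineAction n ε F) (ι : M → F) (z : CotangentBundle E M)
    (X : DefLie n ε) : momentum a ι z X =
      covector z (derivLeftInverse E ι z.proj (a.A X (ι z.proj)))
        + a.f X (ι z.proj) := rfl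

theorem momentum_extChartAt_symm (a : AffineAction n ε F) (ι : M → F) (z₀ : CotangentBundle E M)
    {y : E × (E →L[ℝ] ℝ)} (hy : y.1 ∈ (extChartAt 𝓘(ℝ, E) z₀.proj).target) :
    momentum a ι ((extChartAt (cotangentModel E) z₀).symm y) =
      localMomentum a (ι ∘ (extChartAt 𝓘(ℝ, E) z₀.proj).symm) (chartField a ι z₀.proj) y := by
  rw [cotangent_extChartAt_symm z₀ hy]
  rfl

namespace AffineAction.IsHomogeneous

variable {a : AffineAction n ε F} {ι : M → F}

omit [IsManifold 𝓘(ℝ, E) ∞ M] in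
theorem derivLeftInverse_modelDeriv (h : a.IsHomogeneous (E := E) ι) (q : M) (e : E) :
    derivLeftInverse E ι q (modelDeriv E ι q e) = e :=
  LinearMap.leftInverse_apply_of_inj (f := (modelDeriv E ι q : E →ₗ[ℝ] F))
    (LinearMap.ker_eq_bot.2 (h.injective q)) e

omit [IsManifold 𝓘(ℝ, E) ∞ M] in
-- Since `A X q` is tangent to `M`, the arbitrary choice in the left inverse does not affect the
-- momentum map.
theorem modelDeriv_derivLeftInverse (h : a.IsHomogeneous (E := E) ι) (q : M) (X : DefLie n ε) :
    modelDeriv E ι q (derivLeftInverse E ι q (a.A X (ι q))) = a.A X (ι q) := by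
  obtain ⟨e, he⟩ : ∃ e : E, modelDeriv E ι q e = a.A X (ι q) := h.mem_range X q
  rw [← he, h.derivLeftInverse_modelDeriv]

omit [IsManifold 𝓘(ℝ, E) ∞ M] in
-- The values of `Φ z` on the translations are those of linear functions at the base point, so they
-- determine it.
theorem P_momentum (a : AffineAction n ε F) (ι : M → F) (z : CotangentBundle E M) :
    a.P (momentum a ι z) = ι z.proj := by
  by_contra hne
  obtain ⟨φ, hφ⟩ := SeparatingDual.exists_ne_zero (R := ℝ) (sub_ne_zero.2 hne)
  apply hφ
  rw [map_sub, a.P_apply, momentum_apply, a.A_T, a.f_T]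
  simp

omit [IsManifold 𝓘(ℝ, E) ∞ M] in
-- Recovers the covector from `Φ z`: the element `R q v` moves `q` along `v` and has no translation
-- part.
theorem momentum_R (h : a.IsHomogeneous (E := E) ι) (z : CotangentBundle E M) (e : E) :
    momentum a ι z (a.R (ι z.proj) (modelDeriv E ι z.proj e)) = covector z e := by
  have hA : a.A (a.R (ι z.proj) (modelDeriv E ι z.proj e)) (ι z.proj) = modelDeriv E ι z.proj e :=
    h.A_R z.proj _ ⟨e, rfl⟩
  rw [momentum_apply, a.f_R, hA, h.derivLeftInverse_modelDeriv]
  simp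

theorem contDiffOn_comp_symm (h : a.IsHomogeneous (E := E) ι) (q₀ : M) :
    ContDiffOn ℝ ∞ (ι ∘ (extChartAt 𝓘(ℝ, E) q₀).symm) (extChartAt 𝓘(ℝ, E) q₀).target := by
  rw [← contMDiffOn_iff_contDiffOn]
  exact h.contMDiff.comp_contMDiffOn (contMDiffOn_extChartAt_symm q₀)

theorem fderiv_comp_symm (h : a.IsHomogeneous (E := E) ι) {q₀ : M} {u : E}
    (hu : u ∈ (extChartAt 𝓘(ℝ, E) q₀).target) :
    fderiv ℝ (ι ∘ (extChartAt 𝓘(ℝ, E) q₀).symm) u =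
      (modelDeriv E ι ((extChartAt 𝓘(ℝ, E) q₀).symm u)).comp (chartSymmDeriv q₀ u) := by
  rw [← mfderiv_eq_fderiv, mfderiv_comp u (h.contMDiff.mdifferentiableAt (by simp))
    (((contMDiffOn_extChartAt_symm (n := ∞) q₀ u hu).contMDiffAt
        ((isOpen_extChartAt_target q₀).mem_nhds hu)).mdifferentiableAt (by simp))]
  rfl

theorem localParam (h : a.IsHomogeneous (E := E) ι) (q₀ : M) :
    a.LocalParam (extChartAt 𝓘(ℝ, E) q₀).target (ι ∘ (extChartAt 𝓘(ℝ, E) q₀).symm)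
      (chartField a ι q₀) := by
  have hinj : ∀ u ∈ (extChartAt 𝓘(ℝ, E) q₀).target,
      Function.Injective (fderiv ℝ (ι ∘ (extChartAt 𝓘(ℝ, E) q₀).symm) u) := by
    intro u hu
    rw [h.fderiv_comp_symm hu]
    exact (h.injective _).comp
      (Function.LeftInverse.injective (chartDeriv_chartSymmDeriv hu))
  have hfd : ∀ X, ∀ u ∈ (extChartAt 𝓘(ℝ, E) q₀).target,
      fderiv ℝ (ι ∘ (extChartAt 𝓘(ℝ, E) q₀).symm) u (chartField a ι q₀ X u) =
        a.A X ((ι ∘ (extChartAt 𝓘(ℝ, E) q₀).symm) u) := by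
    intro X u hu
    rw [h.fderiv_comp_symm hu]
    simp only [chartField, LinearMap.coe_mk, AddHom.coe_mk, ContinuousLinearMap.comp_apply]
    rw [chartSymmDeriv_chartDeriv hu, h.modelDeriv_derivLeftInverse]
    rfl
  refine ⟨isOpen_extChartAt_target q₀, h.contDiffOn_comp_symm q₀, hinj, hfd, fun u hu e => ?_⟩
  refine ⟨a.R ((ι ∘ (extChartAt 𝓘(ℝ, E) q₀).symm) u)
    (fderiv ℝ (ι ∘ (extChartAt 𝓘(ℝ, E) q₀).symm) u e), hinj u hu ?_⟩
  rw [hfd _ u hu, h.fderiv_comp_symm hu]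
  exact h.A_R _ _ ⟨_, rfl⟩

theorem momentum_eventuallyEq (a : AffineAction n ε F) (ι : M → F) (z : CotangentBundle E M) :
    momentum a ι =ᶠ[𝓝 z] localMomentum a (ι ∘ (extChartAt 𝓘(ℝ, E) z.proj).symm)
      (chartField a ι z.proj) ∘ extChartAt (cotangentModel E) z := by
  filter_upwards [extChartAt_source_mem_nhds (I := cotangentModel E) z] with z' hz'
  have h1 := (extChartAt (cotangentModel E) z).map_source hz'
  rw [cotangent_extChartAt_target] at h1
  rw [Function.comp_apply, ← momentum_extChartAt_symm a ι z h1.1,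
    (extChartAt (cotangentModel E) z).left_inv hz']

theorem bijective_mfderiv_cotangent_chart (z : CotangentBundle E M) : Function.Bijective
    (mfderiv (cotangentModel E) 𝓘(ℝ, E × (E →L[ℝ] ℝ)) (extChartAt (cotangentModel E) z) z) := by
  have : IsManifold (cotangentModel E) 1 (CotangentBundle E M) :=
    IsManifold.of_le (n := ∞) (by simp)
  exact (isInvertible_mfderiv_extChartAt (I := cotangentModel E)
    (mem_extChartAt_source (I := cotangentModel E) z)).bijective

theorem contMDiffAt_cotangent_chart (z : CotangentBundle E M) :
    ContMDiffAt (cotangentModel E) 𝓘(ℝ, E × (E →L[ℝ] ℝ)) ∞ (extChartAt (cotangentModel E) z) z :=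
  contMDiffAt_extChartAt

theorem momentum_chart (z : CotangentBundle E M) :
    localMomentum a (ι ∘ (extChartAt 𝓘(ℝ, E) z.proj).symm) (chartField a ι z.proj)
      (extChartAt (cotangentModel E) z z) = momentum a ι z :=
  (momentum_eventuallyEq a ι z).self_of_nhds.symm

variable [FiniteDimensional ℝ E] [FiniteDimensional ℝ F]

theorem contMDiffAt_localMomentum (h : a.IsHomogeneous (E := E) ι) (z : CotangentBundle E M) :
    ContMDiffAt 𝓘(ℝ, E × (E →L[ℝ] ℝ)) 𝓘(ℝ, DefLieDual n ε) ∞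
      (localMomentum a (ι ∘ (extChartAt 𝓘(ℝ, E) z.proj).symm) (chartField a ι z.proj))
      (extChartAt (cotangentModel E) z z) :=
  ((h.localParam z.proj).contDiffAt_localMomentum (y := extChartAt (cotangentModel E) z z)
    (mem_extChartAt_target (I := 𝓘(ℝ, E)) z.proj)).contMDiffAt

theorem contMDiff_momentum (h : a.IsHomogeneous (E := E) ι) :
    ContMDiff (cotangentModel E) 𝓘(ℝ, DefLieDual n ε) ∞
      (momentum a ι : CotangentBundle E M → DefLieDual n ε) := fun z =>
  ((h.contMDiffAt_localMomentum z).comp z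
    (contMDiffAt_extChartAt (I := cotangentModel E) (x := z))).congr_of_eventuallyEq
    (momentum_eventuallyEq a ι z)

theorem mfderiv_momentum (h : a.IsHomogeneous (E := E) ι) (z : CotangentBundle E M) :
    mfderiv (cotangentModel E) 𝓘(ℝ, DefLieDual n ε) (momentum a ι) z =
      (fderiv ℝ (localMomentum a (ι ∘ (extChartAt 𝓘(ℝ, E) z.proj).symm) (chartField a ι z.proj))
        (extChartAt (cotangentModel E) z z)).comp
      (mfderiv (cotangentModel E) 𝓘(ℝ, E × (E →L[ℝ] ℝ)) (extChartAt (cotangentModel E) z) z) := by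
  rw [(momentum_eventuallyEq a ι z).mfderiv_eq,
    mfderiv_comp z ((h.contMDiffAt_localMomentum z).mdifferentiableAt (by simp))
      ((contMDiffAt_cotangent_chart z).mdifferentiableAt (by simp)), mfderiv_eq_fderiv]
  rfl

/-- `P` recovers the base point and `R` the covector, both continuously in `Φ z`. Hence convergence
of `Φ z'` forces convergence of both chart coordinates of `z'`. -/
theorem isEmbedding_momentum (h : a.IsHomogeneous (E := E) ι) :
    IsEmbedding (momentum a ι : CotangentBundle E M → DefLieDual n ε) := by
  refine ⟨isInducing_iff_nhds.2 fun z => le_antisymm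
    (h.contMDiff_momentum.continuous.tendsto z).le_comap ?_, ?_⟩
  · set l : Filter (CotangentBundle E M) := Filter.comap (momentum a ι) (𝓝 (momentum a ι z))
    set q₀ := z.proj with hq₀
    set c₀ := extChartAt 𝓘(ℝ, E) q₀ with hc₀
    have hΦ : Filter.Tendsto (momentum a ι) l (𝓝 (momentum a ι z)) := Filter.tendsto_comap
    have hι : Filter.Tendsto (fun z' : CotangentBundle E M => ι z'.proj) l (𝓝 (ι q₀)) := by
      have h1 := (a.P.continuous.tendsto (momentum a ι z)).comp hΦ
      rw [P_momentum] at h1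
      exact h1.congr fun z' => P_momentum a ι z'
    have hproj : Filter.Tendsto (TotalSpace.proj : CotangentBundle E M → M) l (𝓝 q₀) := by
      rwa [h.isEmbedding.tendsto_nhds_iff]
    have hsrc : ∀ᶠ z' in l, z'.proj ∈ c₀.source :=
      hproj (extChartAt_source_mem_nhds (I := 𝓘(ℝ, E)) q₀)
    have hfst : Filter.Tendsto (fun z' : CotangentBundle E M => c₀ z'.proj) l (𝓝 (c₀ q₀)) :=
      ((continuousAt_extChartAt (I := 𝓘(ℝ, E)) q₀).tendsto).comp hproj
    have hsnd : Filter.Tendsto (fun z' => (extChartAt (cotangentModel E) z z').2) l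
        (𝓝 (extChartAt (cotangentModel E) z z).2) := by
      let G : CotangentBundle E M → E →L[ℝ] ℝ := fun z' => (momentum a ι z').comp
        ((a.R (ι z'.proj)).comp (fderiv ℝ (ι ∘ c₀.symm) (c₀ z'.proj)))
      have hG : ∀ z' : CotangentBundle E M, z'.proj ∈ c₀.source →
          G z' = (extChartAt (cotangentModel E) z z').2 := by
        intro z' hz'
        have hu : c₀ z'.proj ∈ c₀.target := c₀.map_source hz'
        refine ContinuousLinearMap.ext fun e => ?_
        rw [cotangent_extChartAt_snd hz']
        simp only [G, ContinuousLinearMap.comp_apply]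
        rw [h.fderiv_comp_symm hu, c₀.left_inv hz', ContinuousLinearMap.comp_apply, h.momentum_R]
        rfl
      have hderiv : Filter.Tendsto (fun z' : CotangentBundle E M =>
          fderiv ℝ (ι ∘ c₀.symm) (c₀ z'.proj)) l (𝓝 (fderiv ℝ (ι ∘ c₀.symm) (c₀ q₀))) :=
        (((h.localParam q₀).contDiffAt_fderiv
          (mem_extChartAt_target (I := 𝓘(ℝ, E)) q₀)).continuousAt.tendsto).comp hfst
      have hGt : Filter.Tendsto G l (𝓝 (G z)) :=
        (isBoundedBilinearMap_comp (𝕜 := ℝ)).continuous.tendsto _ |>.comp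
          (hΦ.prodMk_nhds ((isBoundedBilinearMap_comp (𝕜 := ℝ)).continuous.tendsto _ |>.comp
            (((a.R.continuous.tendsto _).comp hι).prodMk_nhds hderiv)))
      rw [← hG z (mem_extChartAt_source (I := 𝓘(ℝ, E)) q₀)]
      exact hGt.congr' (hsrc.mono hG)
    have hchart : Filter.Tendsto (extChartAt (cotangentModel E) z) l
        (𝓝 (extChartAt (cotangentModel E) z z)) := hfst.prodMk_nhds hsnd
    have hsymm := (continuousAt_extChartAt_symm (I := cotangentModel E) z).tendsto.comp hchart
    rw [extChartAt_to_inv] at hsymm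
    refine Filter.tendsto_id'.1 (hsymm.congr' (hsrc.mono fun z' hz' => ?_))
    refine (extChartAt (cotangentModel E) z).left_inv ?_
    rw [cotangent_extChartAt_source]
    exact hz'
  · rintro ⟨q, η⟩ ⟨q', η'⟩ hz
    have hq : q = q' := h.isEmbedding.injective (by
      have := congrArg a.P hz
      rwa [P_momentum a ι, P_momentum a ι] at this)
    subst hq
    congr 1
    refine ContinuousLinearMap.ext fun e => ?_
    have h1 := h.momentum_R ⟨q, η⟩ e
    have h2 := h.momentum_R ⟨q, η'⟩ e
    rw [hz] at h1
    exact h1.symm.trans h2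

theorem isSymplectomorphismOnto (h : a.IsHomogeneous (E := E) ι) :
    IsSymplectomorphismOnto (momentum a ι : CotangentBundle E M → DefLieDual n ε)
      (range (momentum a ι : CotangentBundle E M → DefLieDual n ε)) where
  contMDiff := h.contMDiff_momentum
  isEmbedding := h.isEmbedding_momentum
  injective_mfderiv z := by
    rw [h.mfderiv_momentum]
    exact ((h.localParam z.proj).injective_fderiv_localMomentum
      (mem_extChartAt_target (I := 𝓘(ℝ, E)) z.proj)).comp (bijective_mfderiv_cotangent_chart z).1
  range_eq := rfl
  range_mfderiv z := by
    rw [h.mfderiv_momentum, ← momentum_chart, ← (h.localParam z.proj).range_fderiv_localMomentum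
      (mem_extChartAt_target (I := 𝓘(ℝ, E)) z.proj)]
    exact (bijective_mfderiv_cotangent_chart z).2.range_comp _
  pullback_eq z u v X Y hu hv := by
    rw [h.mfderiv_momentum, ← momentum_chart] at hu hv
    rw [cotangentForm_eq, ← momentum_chart]
    exact (h.localParam z.proj).form_eq_of_fderiv_eq_coad
      (mem_extChartAt_target (I := 𝓘(ℝ, E)) z.proj) hu hv

end AffineAction.IsHomogeneous

end Momentum

/-! ### The action on a quadric -/

/-- Parameters with `ε₃² = ε₁ ε₂`, written as `ε = s (α², β², α β)` with `s = ±1`. -/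
structure ConeParam (ε : Params) where
  α : ℝ
  β : ℝ
  s : ℝ
  s_mul_s : s * s = 1
  ne_zero : α ^ 2 + β ^ 2 ≠ 0
  ε₁_eq : ε.ε₁ = s * α ^ 2
  ε₂_eq : ε.ε₂ = s * β ^ 2
  ε₃_eq : ε.ε₃ = s * α * β

namespace ConeParam

variable {n : ℕ} {ε : Params}

/-- The rotation part of an element of `𝔤ₙ(ε)`. -/
def rot : DefLie n ε →ₗ[ℝ] Matrix (Fin n) (Fin n) ℝ where
  toFun X := Matrix.of fun i j => X.toMat (.inl i) (.inl j)
  map_add' X Y := by ext i j; simp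
  map_smul' c X := by ext i j; simp

/-- The part of an element of `𝔤ₙ(ε)` that rotates the time axis. -/
def boost (c : ConeParam ε) : DefLie n ε →ₗ[ℝ] Fin n → ℝ where
  toFun X i := c.α * X.toMat (.inl i) (.inr 0) + c.β * X.toMat (.inl i) (.inr 1)
  map_add' X Y := by ext i; simp; ring
  map_smul' r X := by ext i; simp; ring

/-- The spatial translation part of an element of `𝔤ₙ(ε)`. -/
def trans (c : ConeParam ε) : DefLie n ε →ₗ[ℝ] Fin n → ℝ where
  toFun X i := (c.β * X.toMat (.inl i) (.inr 0) - c.α * X.toMat (.inl i) (.inr 1)) /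
    (c.α ^ 2 + c.β ^ 2)
  map_add' X Y := by ext i; simp; ring
  map_smul' r X := by ext i; simp; ring

/-- The time translation part of an element of `𝔤ₙ(ε)`. -/
def time : DefLie n ε →ₗ[ℝ] ℝ where
  toFun X := X.toMat (.inr 0) (.inr 1)
  map_add' X Y := by simp
  map_smul' r X := by simp

theorem rot_apply (X : DefLie n ε) (i j : Fin n) : rot X i j = X.toMat (.inl i) (.inl j) := rfl

theorem boost_apply (c : ConeParam ε) (X : DefLie n ε) (i : Fin n) : c.boost X i =
    c.α * X.toMat (.inl i) (.inr 0) + c.β * X.toMat (.inl i) (.inr 1) := rfl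

theorem trans_apply (c : ConeParam ε) (X : DefLie n ε) (i : Fin n) : c.trans X i =
    (c.β * X.toMat (.inl i) (.inr 0) - c.α * X.toMat (.inl i) (.inr 1)) /
      (c.α ^ 2 + c.β ^ 2) := rfl

theorem time_apply (X : DefLie n ε) : time X = X.toMat (.inr 0) (.inr 1) := rfl

/-! ### The bracket in terms of rotations, boosts and translations. -/

section Lie

theorem toMat_swap (X : DefLie n ε) (a b : Idx n) : X.toMat b a = -X.toMat a b := X.2 a b

theorem rot_transpose (X : DefLie n ε) : (rot X)ᵀ = -rot X := by
  ext i j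
  exact toMat_swap X _ _

theorem dotProduct_rot_mulVec (X : DefLie n ε) (v w : Fin n → ℝ) :
    v ⬝ᵥ (rot X *ᵥ w) = -((rot X *ᵥ v) ⬝ᵥ w) := by
  rw [Matrix.dotProduct_mulVec, ← Matrix.mulVec_transpose, rot_transpose, Matrix.neg_mulVec,
    neg_dotProduct]

theorem toMat_self (X : DefLie n ε) (a : Idx n) : X.toMat a a = 0 := by
  have := toMat_swap X a a
  linarith

variable (c : ConeParam ε)

/-- On the last two coordinates the Gram matrix is `s` times the square of the functional `(α, β)`.
So the bracket sees these coordinates only through that functional. -/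
theorem toMat_lie_apply (X Y : DefLie n ε) (a b : Idx n) : (⁅X, Y⁆ : DefLie n ε).toMat a b =
    ∑ k, (Y.toMat a (.inl k) * X.toMat (.inl k) b - X.toMat a (.inl k) * Y.toMat (.inl k) b)
    + c.s * ((c.α * Y.toMat a (.inr 0) + c.β * Y.toMat a (.inr 1)) *
        (c.α * X.toMat (.inr 0) b + c.β * X.toMat (.inr 1) b)
      - (c.α * X.toMat a (.inr 0) + c.β * X.toMat a (.inr 1)) *
        (c.α * Y.toMat (.inr 0) b + c.β * Y.toMat (.inr 1) b)) := by
  have key : ∀ A B : Matrix (Idx n) (Idx n) ℝ, (A * deformedGram n ε * B) a b =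
      ∑ k, A a (.inl k) * B (.inl k) b
      + c.s * ((c.α * A a (.inr 0) + c.β * A a (.inr 1)) *
        (c.α * B (.inr 0) b + c.β * B (.inr 1) b)) := by
    intro A B
    simp only [Matrix.mul_apply, Fintype.sum_sum_type, Fin.sum_univ_two, deformedGram,
      Matrix.fromBlocks_apply₁₁, Matrix.fromBlocks_apply₁₂, Matrix.fromBlocks_apply₂₁,
      Matrix.fromBlocks_apply₂₂, Matrix.one_apply, Matrix.zero_apply, Matrix.of_apply,
      Matrix.cons_val', Matrix.cons_val_zero, Matrix.cons_val_one, mul_zero, Finset.sum_const_zero,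
      mul_ite, mul_one, Finset.sum_ite_eq', Finset.mem_univ, if_true, add_zero, zero_add,
      c.ε₁_eq, c.ε₂_eq, c.ε₃_eq]
    simp
    ring
  rw [DefLie.toMat_lie, Matrix.sub_apply, key, key, Finset.sum_sub_distrib]
  ring

theorem rot_lie (X Y : DefLie n ε) : rot ⁅X, Y⁆ = rot Y * rot X - rot X * rot Y
    - c.s • Matrix.vecMulVec (c.boost Y) (c.boost X)
    + c.s • Matrix.vecMulVec (c.boost X) (c.boost Y) := by
  ext i j
  simp only [rot_apply, boost_apply, Matrix.add_apply,
    Matrix.sub_apply, Matrix.smul_apply, Matrix.vecMulVec_apply, Matrix.mul_apply, smul_eq_mul]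
  rw [c.toMat_lie_apply, toMat_swap X (.inl j) (.inr 0), toMat_swap X (.inl j) (.inr 1),
    toMat_swap Y (.inl j) (.inr 0), toMat_swap Y (.inl j) (.inr 1), Finset.sum_sub_distrib]
  ring

theorem boost_lie (X Y : DefLie n ε) :
    c.boost ⁅X, Y⁆ = rot Y *ᵥ c.boost X - rot X *ᵥ c.boost Y := by
  ext i
  simp only [rot_apply, boost_apply, Pi.sub_apply, Matrix.mulVec, dotProduct]
  rw [c.toMat_lie_apply, c.toMat_lie_apply, toMat_swap X (.inr 0) (.inr 1), toMat_self X,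
    toMat_self X, toMat_swap Y (.inr 0) (.inr 1), toMat_self Y, toMat_self Y,
    ← Finset.sum_sub_distrib]
  simp only [mul_add, Finset.mul_sum]
  -- All sums are gathered into one whose terms vanish identically; the rest is scalar algebra.
  rw [add_add_add_comm, ← Finset.sum_add_distrib, ← sub_eq_zero, add_sub_right_comm,
    ← Finset.sum_sub_distrib, Finset.sum_eq_zero]
  · ring
  · intros; ring

theorem trans_lie (X Y : DefLie n ε) :
    c.trans ⁅X, Y⁆ = rot Y *ᵥ c.trans X - rot X *ᵥ c.trans Y
      - (c.s * time X) • c.boost Y + (c.s * time Y) • c.boost X := by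
  have hN := c.ne_zero
  ext i
  simp only [rot_apply, boost_apply, trans_apply, time_apply, Pi.sub_apply, Pi.add_apply,
    Pi.smul_apply, smul_eq_mul, Matrix.mulVec, dotProduct]
  rw [c.toMat_lie_apply, c.toMat_lie_apply, toMat_swap X (.inr 0) (.inr 1), toMat_self X,
    toMat_self X, toMat_swap Y (.inr 0) (.inr 1), toMat_self Y, toMat_self Y,
    ← Finset.sum_sub_distrib]
  have hsum : (c.β * ∑ k, (Y.toMat (.inl i) (.inl k) * X.toMat (.inl k) (.inr 0) -
        X.toMat (.inl i) (.inl k) * Y.toMat (.inl k) (.inr 0)) -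
      c.α * ∑ k, (Y.toMat (.inl i) (.inl k) * X.toMat (.inl k) (.inr 1) -
        X.toMat (.inl i) (.inl k) * Y.toMat (.inl k) (.inr 1))) / (c.α ^ 2 + c.β ^ 2) =
      ∑ k, (Y.toMat (.inl i) (.inl k) *
        ((c.β * X.toMat (.inl k) (.inr 0) - c.α * X.toMat (.inl k) (.inr 1)) /
          (c.α ^ 2 + c.β ^ 2)) -
        X.toMat (.inl i) (.inl k) *
        ((c.β * Y.toMat (.inl k) (.inr 0) - c.α * Y.toMat (.inl k) (.inr 1)) /
          (c.α ^ 2 + c.β ^ 2))) := by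
    rw [Finset.mul_sum, Finset.mul_sum, ← Finset.sum_sub_distrib, Finset.sum_div]
    exact Finset.sum_congr rfl fun k _ => by ring
  rw [← hsum]
  field_simp
  ring

theorem time_lie (X Y : DefLie n ε) :
    time ⁅X, Y⁆ = c.trans X ⬝ᵥ c.boost Y - c.trans Y ⬝ᵥ c.boost X := by
  have hN := c.ne_zero
  simp only [boost_apply, trans_apply, time_apply, dotProduct]
  rw [c.toMat_lie_apply, toMat_self X, toMat_self X, toMat_self Y, toMat_self Y,
    ← sub_eq_zero, ← Finset.sum_sub_distrib, add_sub_right_comm, ← Finset.sum_sub_distrib,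
    Finset.sum_eq_zero]
  · ring
  · intro k _
    rw [toMat_swap X (.inl k) (.inr 0), toMat_swap Y (.inl k) (.inr 0)]
    field_simp
    ring

end Lie

end ConeParam

namespace ConeParam

variable {n : ℕ} {ε : Params}

/-! ### Components of the standard generators. -/

section Generators

open DefLie

theorem rot_l (i j : Fin n) :
    rot (l n ε i j) = Matrix.single i j 1 - Matrix.single j i 1 := by
  ext a b
  simp [rot_apply, l, wedge, Matrix.single_apply]

theorem rot_x (i : Fin n) : rot (x n ε i) = 0 := by
  ext a b
  simp [rot_apply, x, wedge]

theorem rot_p (i : Fin n) : rot (p n ε i) = 0 := by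
  ext a b
  simp [rot_apply, p, wedge]

theorem rot_I : rot (I n ε) = 0 := by
  ext a b
  simp [rot_apply, I, wedge]

theorem time_l (i j : Fin n) : time (l n ε i j) = 0 := by
  simp [time_apply, l, wedge]

theorem time_x (i : Fin n) : time (x n ε i) = 0 := by
  simp [time_apply, x, wedge]

theorem time_p (i : Fin n) : time (p n ε i) = 0 := by
  simp [time_apply, p, wedge]

theorem time_I : time (I n ε) = 1 := by
  simp [time_apply, I, wedge]

variable (c : ConeParam ε)

theorem boost_l (i j : Fin n) : c.boost (l n ε i j) = 0 := by
  ext a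
  simp [boost_apply, l, wedge]

theorem boost_x (i : Fin n) : c.boost (x n ε i) = Pi.single i c.α := by
  ext a
  simp [boost_apply, x, wedge, Matrix.single_apply, Pi.single_apply, eq_comm]

theorem boost_p (i : Fin n) : c.boost (p n ε i) = Pi.single i c.β := by
  ext a
  simp [boost_apply, p, wedge, Matrix.single_apply, Pi.single_apply, eq_comm]

theorem boost_I : c.boost (I n ε) = 0 := by
  ext a
  simp [boost_apply, I, wedge]

theorem trans_l (i j : Fin n) : c.trans (l n ε i j) = 0 := by
  ext a
  simp [trans_apply, l, wedge]

theorem trans_x (i : Fin n) :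
    c.trans (x n ε i) = Pi.single i (c.β / (c.α ^ 2 + c.β ^ 2)) := by
  ext a
  simp [trans_apply, x, wedge, Matrix.single_apply, Pi.single_apply, eq_comm, ite_div]

theorem trans_p (i : Fin n) :
    c.trans (p n ε i) = Pi.single i (-c.α / (c.α ^ 2 + c.β ^ 2)) := by
  ext a
  rcases eq_or_ne a i with rfl | h
  · simp [trans_apply, p, wedge]
  · simp [trans_apply, p, wedge, h, h.symm]

theorem trans_I : c.trans (I n ε) = 0 := by
  ext a
  simp [trans_apply, I, wedge]

/-- The expansion of an element of `𝔤ₙ(ε)` in the standard generators. -/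
theorem sum_generators (X : DefLie n ε) :
    X = (∑ i, ∑ j, (X.toMat (.inl i) (.inl j) / 2) • l n ε i j)
      + (∑ i, X.toMat (.inl i) (.inr 0) • x n ε i)
      + (∑ i, X.toMat (.inl i) (.inr 1) • p n ε i)
      + X.toMat (.inr 0) (.inr 1) • I n ε := by
  have hadd : ∀ (A B : DefLie n ε) (a b : Idx n), (A + B).toMat a b = A.toMat a b + B.toMat a b :=
    fun _ _ _ _ => rfl
  have hsmul : ∀ (r : ℝ) (A : DefLie n ε) (a b : Idx n), (r • A).toMat a b = r * A.toMat a b :=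
    fun _ _ _ _ => rfl
  have hsum : ∀ (f : Fin n → DefLie n ε) (a b : Idx n),
      (∑ i, f i).toMat a b = ∑ i, (f i).toMat a b := fun f a b =>
    map_sum (AddMonoidHom.mk' (fun A : DefLie n ε => A.toMat a b) fun A B => hadd A B a b) f _
  apply toMat_injective
  ext a b
  simp only [hadd, hsmul, hsum]
  have hs := toMat_swap X
  rcases a with a | a <;> rcases b with b | b
  -- The sum over ordered pairs counts each rotation twice, which accounts for the factor `1/2`;
  -- skewness splits the entry accordingly.
  · rw [show X.toMat (.inl a) (.inl b) = X.toMat (.inl a) (.inl b) / 2 -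
      X.toMat (.inl b) (.inl a) / 2 by rw [hs (.inl a) (.inl b)]; ring]
    simp [l, x, p, I, wedge, Matrix.single_apply, mul_sub, ite_and, Finset.sum_ite_irrel]
  · fin_cases b <;> simp [l, x, p, I, wedge, Matrix.single_apply]
  · rw [hs (.inl b) (.inr a)]
    fin_cases a <;> simp [l, x, p, I, wedge, Matrix.single_apply]
  · have h0 := toMat_self X
    fin_cases a <;> fin_cases b <;> simp [l, x, p, I, wedge, h0]
    exact hs _ _

theorem dual_ext {ξ ξ' : DefLieDual n ε} (hl : ∀ i j, ξ (l n ε i j) = ξ' (l n ε i j))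
    (hx : ∀ i, ξ (x n ε i) = ξ' (x n ε i)) (hp : ∀ i, ξ (p n ε i) = ξ' (p n ε i))
    (hI : ξ (I n ε) = ξ' (I n ε)) : ξ = ξ' := by
  ext X
  rw [sum_generators X]
  simp only [map_add, map_sum, map_smul, hl, hx, hp, hI]

end Generators

/-! ### The linear action on `ℝ × ℝⁿ`, its cocycle and its sections. -/

variable (c : ConeParam ε)

/-- The linear vector field on `ℝ × ℝⁿ` defined by an element of `𝔤ₙ(ε)`. -/
def linearField (X : DefLie n ε) : (ℝ × (Fin n → ℝ)) →L[ℝ] ℝ × (Fin n → ℝ) :=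
  LinearMap.toContinuousLinearMap
    { toFun := fun q => (-c.s * (c.boost X ⬝ᵥ q.2), q.1 • c.boost X - rot X *ᵥ q.2)
      map_add' := fun q q' => by
        ext
        · simp [dotProduct_add]; ring
        · simp [Matrix.mulVec_add]; ring
      map_smul' := fun r q => by
        ext
        · simp; ring
        · simp [Matrix.mulVec_smul]; ring }

theorem linearField_apply (X : DefLie n ε) (q : ℝ × (Fin n → ℝ)) : c.linearField X q =
    (-c.s * (c.boost X ⬝ᵥ q.2), q.1 • c.boost X - rot X *ᵥ q.2) := rfl

/-- The linear function on `ℝ × ℝⁿ` defined by an element of `𝔤ₙ(ε)`. -/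
def linearFunction (X : DefLie n ε) : (ℝ × (Fin n → ℝ)) →L[ℝ] ℝ :=
  LinearMap.toContinuousLinearMap
    { toFun := fun q => time X * q.1 + c.trans X ⬝ᵥ q.2
      map_add' := fun q q' => by simp [dotProduct_add]; ring
      map_smul' := fun r q => by simp; ring }

theorem linearFunction_apply (X : DefLie n ε) (q : ℝ × (Fin n → ℝ)) :
    c.linearFunction X q = time X * q.1 + c.trans X ⬝ᵥ q.2 := rfl

/-- The element of `𝔤ₙ(ε)` that acts by the translation function `φ`. -/
def translation (φ : (ℝ × (Fin n → ℝ)) →L[ℝ] ℝ) : DefLie n ε :=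
  φ (1, 0) • DefLie.I n ε +
    ∑ i, φ (0, Pi.single i 1) • (c.β • DefLie.x n ε i - c.α • DefLie.p n ε i)

/-- The point of `ℝ × ℝⁿ` underlying an element of the dual of `𝔤ₙ(ε)`. -/
def basePoint : DefLieDual n ε →L[ℝ] ℝ × (Fin n → ℝ) :=
  LinearMap.toContinuousLinearMap
    { toFun := fun ξ => (ξ (DefLie.I n ε),
        fun i => c.β * ξ (DefLie.x n ε i) - c.α * ξ (DefLie.p n ε i))
      map_add' := fun ξ ξ' => by
        ext
        · simp
        · simp; ring
      map_smul' := fun r ξ => by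
        ext
        · simp
        · simp; ring }

theorem basePoint_apply (ξ : DefLieDual n ε) : c.basePoint ξ = (ξ (DefLie.I n ε),
    fun i => c.β * ξ (DefLie.x n ε i) - c.α * ξ (DefLie.p n ε i)) := rfl

/-- The element of `𝔤ₙ(ε)` that rotates `q` in the direction `v`. -/
def rotation : (ℝ × (Fin n → ℝ)) →L[ℝ] (ℝ × (Fin n → ℝ)) →L[ℝ] DefLie n ε :=
  LinearMap.toContinuousBilinearMap <| LinearMap.mk₂ ℝ
    (fun q v => (∑ i, ∑ j, (c.s * (q.2 i * v.2 j)) • DefLie.l n ε i j)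
      + ∑ i, ((q.1 * v.2 i - v.1 * q.2 i) / (c.α ^ 2 + c.β ^ 2)) •
        (c.α • DefLie.x n ε i + c.β • DefLie.p n ε i))
    (fun q q' v => by
      simp only [Prod.fst_add, Prod.snd_add, Pi.add_apply]
      rw [add_add_add_comm]
      simp only [← Finset.sum_add_distrib, ← add_smul]
      refine Finset.sum_congr rfl fun i _ => congrArg₂ (fun a b : DefLie n ε => a + b)
        (Finset.sum_congr rfl fun j _ => ?_) ?_
      · exact congrArg (· • _) (by ring)
      · exact congrArg (· • _) (by ring))
    (fun r q v => by
      simp only [Prod.smul_fst, Prod.smul_snd, Pi.smul_apply, smul_eq_mul, smul_add,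
        Finset.smul_sum, smul_smul]
      congr 1
      · exact Finset.sum_congr rfl fun i _ => Finset.sum_congr rfl fun j _ => by congr 1; ring
      · exact Finset.sum_congr rfl fun i _ => by congr 2 <;> ring)
    (fun q v v' => by
      simp only [Prod.fst_add, Prod.snd_add, Pi.add_apply]
      rw [add_add_add_comm]
      simp only [← Finset.sum_add_distrib, ← add_smul]
      refine Finset.sum_congr rfl fun i _ => congrArg₂ (fun a b : DefLie n ε => a + b)
        (Finset.sum_congr rfl fun j _ => ?_) ?_
      · exact congrArg (· • _) (by ring)
      · exact congrArg (· • _) (by ring))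
    (fun r q v => by
      simp only [Prod.smul_fst, Prod.smul_snd, Pi.smul_apply, smul_eq_mul, smul_add,
        Finset.smul_sum, smul_smul]
      congr 1
      · exact Finset.sum_congr rfl fun i _ => Finset.sum_congr rfl fun j _ => by congr 1; ring
      · exact Finset.sum_congr rfl fun i _ => by congr 2 <;> ring)

theorem rotation_apply (q v : ℝ × (Fin n → ℝ)) : c.rotation q v =
    (∑ i, ∑ j, (c.s * (q.2 i * v.2 j)) • DefLie.l n ε i j)
      + ∑ i, ((q.1 * v.2 i - v.1 * q.2 i) / (c.α ^ 2 + c.β ^ 2)) •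
        (c.α • DefLie.x n ε i + c.β • DefLie.p n ε i) := rfl

theorem rot_rotation (q v : ℝ × (Fin n → ℝ)) : rot (c.rotation q v) =
    c.s • (Matrix.vecMulVec q.2 v.2 - Matrix.vecMulVec v.2 q.2) := by
  rw [rotation_apply]
  simp only [map_add, map_sum, map_smul, rot_l, rot_x, rot_p, smul_zero, add_zero,
    Finset.sum_const_zero]
  ext a b
  simp only [Matrix.sum_apply, Matrix.smul_apply, Matrix.sub_apply, Matrix.single_apply,
    Matrix.vecMulVec_apply, smul_eq_mul, mul_sub, Finset.sum_sub_distrib, ite_and, mul_ite, mul_one,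
    mul_zero, Finset.sum_ite_eq', Finset.mem_univ, if_true, Finset.sum_ite_irrel,
    Finset.sum_const_zero]
  ring

theorem boost_rotation (q v : ℝ × (Fin n → ℝ)) : c.boost (c.rotation q v) =
    q.1 • v.2 - v.1 • q.2 := by
  have hN := c.ne_zero
  rw [rotation_apply]
  simp only [map_add, map_sum, map_smul, boost_l, boost_x, boost_p, smul_zero, zero_add,
    Finset.sum_const_zero]
  ext a
  simp only [Finset.sum_apply, Pi.smul_apply, Pi.add_apply, Pi.single_apply, smul_eq_mul,
    Pi.sub_apply,
    mul_ite, mul_zero, mul_add, Finset.sum_add_distrib, Finset.sum_ite_eq, Finset.mem_univ, if_true]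
  field_simp

theorem trans_rotation (q v : ℝ × (Fin n → ℝ)) : c.trans (c.rotation q v) = 0 := by
  rw [rotation_apply]
  simp only [map_add, map_sum, map_smul, trans_l, trans_x, trans_p, smul_zero, zero_add,
    Finset.sum_const_zero]
  ext a
  simp only [Finset.sum_apply, Pi.smul_apply, Pi.add_apply, Pi.single_apply, smul_eq_mul,
    mul_ite, mul_zero, mul_add, Finset.sum_add_distrib, Finset.sum_ite_eq, Finset.mem_univ, if_true,
    Pi.zero_apply]
  ring

theorem time_rotation (q v : ℝ × (Fin n → ℝ)) : time (c.rotation q v) = 0 := by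
  rw [rotation_apply]
  simp [time_l, time_x, time_p]

/-- For `⟨q, v⟩ = t t' + s y·y'`, the rotation in the plane of `q` and `v` sends `q` to `⟨q, q⟩ v -
⟨q, v⟩ q`. On the quadric, and for tangent `v`, this is `v`. -/
theorem linearField_rotation (q v : ℝ × (Fin n → ℝ)) : c.linearField (c.rotation q v) q =
    (q.1 ^ 2 + c.s * (q.2 ⬝ᵥ q.2)) • v - (q.1 * v.1 + c.s * (q.2 ⬝ᵥ v.2)) • q := by
  rw [linearField_apply, boost_rotation, rot_rotation, Matrix.smul_mulVec, Matrix.sub_mulVec,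
    Matrix.vecMulVec_mulVec, Matrix.vecMulVec_mulVec]
  ext i
  · simp [sub_dotProduct, dotProduct_comm v.2 q.2]
    ring
  · simp [dotProduct_comm v.2 q.2]
    ring

theorem linearField_lie (X Y : DefLie n ε) (q : ℝ × (Fin n → ℝ)) : c.linearField ⁅X, Y⁆ q =
    c.linearField X (c.linearField Y q) - c.linearField Y (c.linearField X q) := by
  simp only [linearField_apply, c.boost_lie, c.rot_lie]
  refine Prod.ext ?_ ?_
  · simp only [Prod.fst_sub, sub_dotProduct, dotProduct_sub, dotProduct_smul,
      dotProduct_rot_mulVec, dotProduct_comm (c.boost Y) (c.boost X), smul_eq_mul]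
    ring
  · simp only [Prod.snd_sub, Matrix.add_mulVec, Matrix.sub_mulVec, Matrix.smul_mulVec,
      Matrix.vecMulVec_mulVec, Matrix.mulVec_sub, Matrix.mulVec_smul, ← Matrix.mulVec_mulVec]
    ext i
    simp
    ring

theorem linearFunction_lie (X Y : DefLie n ε) (q : ℝ × (Fin n → ℝ)) :
    c.linearFunction ⁅X, Y⁆ q =
      c.linearFunction X (c.linearField Y q) - c.linearFunction Y (c.linearField X q) := by
  simp only [linearField_apply, linearFunction_apply, c.trans_lie, c.time_lie, add_dotProduct,
    sub_dotProduct, dotProduct_sub, dotProduct_smul, smul_dotProduct, dotProduct_rot_mulVec,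
    smul_eq_mul]
  ring

/-- The translations lie in the kernel of the linear action: `β xᵢ - α pᵢ` is `vᵢ ∧ r` with `r` in
the radical. -/
theorem rot_translation (φ : (ℝ × (Fin n → ℝ)) →L[ℝ] ℝ) : rot (translation c φ) = 0 := by
  simp [translation, rot_I, rot_x, rot_p]

theorem boost_translation (φ : (ℝ × (Fin n → ℝ)) →L[ℝ] ℝ) : c.boost (translation c φ) = 0 := by
  simp only [translation, map_add, map_sum, map_smul, map_sub, boost_I, boost_x, boost_p,
    smul_zero, zero_add]
  refine Finset.sum_eq_zero fun i _ => ?_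
  rw [← Pi.single_smul, ← Pi.single_smul, smul_eq_mul, smul_eq_mul, mul_comm, sub_self, smul_zero]

theorem time_translation (φ : (ℝ × (Fin n → ℝ)) →L[ℝ] ℝ) : time (translation c φ) = φ (1, 0) := by
  simp [translation, time_I, time_x, time_p]

theorem trans_translation (φ : (ℝ × (Fin n → ℝ)) →L[ℝ] ℝ) (i : Fin n) :
    c.trans (translation c φ) i = φ (0, Pi.single i 1) := by
  have hN := c.ne_zero
  simp only [translation, map_add, map_sum, map_smul, map_sub, trans_I, trans_x, trans_p,
    smul_zero, zero_add]
  simp only [Finset.sum_apply, Pi.smul_apply, Pi.sub_apply, Pi.single_apply, smul_eq_mul,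
    mul_ite, mul_zero, mul_sub, Finset.sum_sub_distrib, Finset.sum_ite_eq, Finset.mem_univ, if_true]
  field_simp
  ring

theorem clm_apply_eq_sum (φ : (ℝ × (Fin n → ℝ)) →L[ℝ] ℝ) (q : ℝ × (Fin n → ℝ)) :
    φ q = φ (1, 0) * q.1 + ∑ i, φ (0, Pi.single i 1) * q.2 i := by
  have hq : q = q.1 • (1, 0) + ∑ i, q.2 i • ((0, Pi.single i 1) : ℝ × (Fin n → ℝ)) := by
    refine Prod.ext ?_ ?_
    · simp [Prod.fst_sum]
    · ext j
      simp [Prod.snd_sum, Finset.sum_apply, Pi.single_apply]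
  conv_lhs => rw [hq]
  simp only [map_add, map_sum, map_smul, smul_eq_mul]
  simp only [mul_comm]

/-- The action of `𝔤ₙ(ε)` on the cotangent bundle of `ℝ × ℝⁿ`. -/
def action : AffineAction n ε (ℝ × (Fin n → ℝ)) where
  A :=
    { toFun := c.linearField
      map_add' := fun X Y => by
        refine ContinuousLinearMap.ext fun q => ?_
        rw [add_apply]
        simp only [linearField_apply, map_add]
        ext
        · simp [add_dotProduct]; ring
        · simp [Matrix.add_mulVec]; ring
      map_smul' := fun r X => by
        refine ContinuousLinearMap.ext fun q => ?_
        rw [smul_apply]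
        simp only [linearField_apply, map_smul]
        ext
        · simp; ring
        · simp [Matrix.smul_mulVec]; ring }
  f :=
    { toFun := c.linearFunction
      map_add' := fun X Y => by
        refine ContinuousLinearMap.ext fun q => ?_
        rw [add_apply]
        simp only [linearFunction_apply, map_add, add_dotProduct]
        ring
      map_smul' := fun r X => by
        refine ContinuousLinearMap.ext fun q => ?_
        rw [smul_apply]
        simp only [linearFunction_apply, map_smul, smul_dotProduct, smul_eq_mul, RingHom.id_apply]
        ring }
  A_lie := c.linearField_lie
  f_lie := c.linearFunction_lie
  T := c.translation
  A_T φ := by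
    refine ContinuousLinearMap.ext fun q => ?_
    change c.linearField _ _ = 0
    rw [linearField_apply, rot_translation, boost_translation]
    simp
  f_T φ := by
    refine ContinuousLinearMap.ext fun q => ?_
    change c.linearFunction _ _ = _
    rw [linearFunction_apply, time_translation, clm_apply_eq_sum φ q, dotProduct]
    simp only [trans_translation]
  P := c.basePoint
  P_apply ξ φ := by
    rw [clm_apply_eq_sum]
    simp only [basePoint_apply, translation, map_add, map_sum, map_smul, map_sub, smul_eq_mul]
  R := c.rotation
  f_R q v := by
    refine ContinuousLinearMap.ext fun q' => ?_
    change c.linearFunction _ _ = 0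
    rw [linearFunction_apply, time_rotation, trans_rotation]
    simp

end ConeParam

/-! ### Parametrization of the special orbits -/

namespace ConeParam

variable {n : ℕ} {ε : Params} (c : ConeParam ε)

/-- The quadric `t² + s |y|² = 1`. -/
def quadric (n : ℕ) : Set (ℝ × (Fin n → ℝ)) := {q | q.1 ^ 2 + c.s * (q.2 ⬝ᵥ q.2) = 1}

/-- The momentum map on the cotangent bundle of `ℝ × ℝⁿ`. -/
def ambientMomentum (q : ℝ × (Fin n → ℝ)) (P : (ℝ × (Fin n → ℝ)) →L[ℝ] ℝ) : DefLieDual n ε :=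
  LinearMap.toContinuousLinearMap
    { toFun := fun X => P (c.action.A X q) + c.action.f X q
      map_add' := fun X Y => by simp only [map_add, add_apply]; ring
      map_smul' := fun r X => by
        simp only [map_smul, smul_apply, smul_eq_mul, RingHom.id_apply]
        ring }

theorem ambientMomentum_apply (q : ℝ × (Fin n → ℝ)) (P : (ℝ × (Fin n → ℝ)) →L[ℝ] ℝ)
    (X : DefLie n ε) :
    c.ambientMomentum q P X = P (c.linearField X q) + c.linearFunction X q := rfl

theorem ambientMomentum_l (q : ℝ × (Fin n → ℝ)) (P : (ℝ × (Fin n → ℝ)) →L[ℝ] ℝ) (i j : Fin n) :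
    c.ambientMomentum q P (DefLie.l n ε i j) =
      q.2 i * P (0, Pi.single j 1) - q.2 j * P (0, Pi.single i 1) := by
  rw [ambientMomentum_apply, linearField_apply, linearFunction_apply, boost_l, rot_l, time_l,
    trans_l, clm_apply_eq_sum]
  simp [Matrix.sub_mulVec, Matrix.single_mulVec, mul_sub, Function.update_apply]
  ring

theorem ambientMomentum_x (q : ℝ × (Fin n → ℝ)) (P : (ℝ × (Fin n → ℝ)) →L[ℝ] ℝ) (i : Fin n) :
    c.ambientMomentum q P (DefLie.x n ε i) =
      c.α * (q.1 * P (0, Pi.single i 1) - c.s * q.2 i * P (1, 0)) +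
        c.β / (c.α ^ 2 + c.β ^ 2) * q.2 i := by
  rw [ambientMomentum_apply, linearField_apply, linearFunction_apply, boost_x, rot_x, time_x,
    trans_x, clm_apply_eq_sum]
  simp [Pi.single_apply]
  ring

theorem ambientMomentum_p (q : ℝ × (Fin n → ℝ)) (P : (ℝ × (Fin n → ℝ)) →L[ℝ] ℝ) (i : Fin n) :
    c.ambientMomentum q P (DefLie.p n ε i) =
      c.β * (q.1 * P (0, Pi.single i 1) - c.s * q.2 i * P (1, 0)) -
        c.α / (c.α ^ 2 + c.β ^ 2) * q.2 i := by
  rw [ambientMomentum_apply, linearField_apply, linearFunction_apply, boost_p, rot_p, time_p,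
    trans_p, clm_apply_eq_sum]
  simp [Pi.single_apply]
  ring

theorem ambientMomentum_I (q : ℝ × (Fin n → ℝ)) (P : (ℝ × (Fin n → ℝ)) →L[ℝ] ℝ) :
    c.ambientMomentum q P (DefLie.I n ε) = q.1 := by
  rw [ambientMomentum_apply, linearField_apply, linearFunction_apply, boost_I, rot_I, time_I,
    trans_I, clm_apply_eq_sum]
  simp

theorem basePoint_ambientMomentum (q : ℝ × (Fin n → ℝ)) (P : (ℝ × (Fin n → ℝ)) →L[ℝ] ℝ) :
    c.basePoint (c.ambientMomentum q P) = q := by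
  have hN := c.ne_zero
  rw [basePoint_apply]
  refine Prod.ext (c.ambientMomentum_I q P) ?_
  ext i
  simp only [ambientMomentum_x, ambientMomentum_p]
  field_simp
  ring

/-- On the cone the coefficient of `l²` vanishes and the remaining terms in `x` and `p` form the
square `s |β x - α p|²`. -/
theorem casimir_eq (ξ : DefLieDual n ε) : casimir n ε ξ =
    -2 * ((c.basePoint ξ).1 ^ 2 + c.s * ((c.basePoint ξ).2 ⬝ᵥ (c.basePoint ξ).2)) := by
  rw [casimir, basePoint_apply, c.ε₁_eq, c.ε₂_eq, c.ε₃_eq, dotProduct]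
  have h0 : (c.s * c.α * c.β) ^ 2 - c.s * c.α ^ 2 * (c.s * c.β ^ 2) = 0 := by ring
  have hs : c.s * ∑ i, (c.β * ξ (DefLie.x n ε i) - c.α * ξ (DefLie.p n ε i)) *
        (c.β * ξ (DefLie.x n ε i) - c.α * ξ (DefLie.p n ε i)) =
      c.s * c.β ^ 2 * ∑ i, ξ (DefLie.x n ε i) ^ 2 + c.s * c.α ^ 2 * ∑ i, ξ (DefLie.p n ε i) ^ 2
        - 2 * (c.s * c.α * c.β) * ∑ i, ξ (DefLie.x n ε i) * ξ (DefLie.p n ε i) := by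
    simp only [Finset.mul_sum, ← Finset.sum_add_distrib, ← Finset.sum_sub_distrib]
    exact Finset.sum_congr rfl fun i _ => by ring
  rw [h0, hs]
  ring

theorem ambientMomentum_mem {q : ℝ × (Fin n → ℝ)} (hq : q ∈ c.quadric n)
    (P : (ℝ × (Fin n → ℝ)) →L[ℝ] ℝ) : c.ambientMomentum q P ∈ specialOrbit n ε := by
  have hN := c.ne_zero
  refine ⟨?_, ?_, ?_, ?_, ?_⟩
  · rw [c.casimir_eq, basePoint_ambientMomentum, show q.1 ^ 2 + c.s * (q.2 ⬝ᵥ q.2) = 1 from hq]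
    norm_num
  · intro i j
    simp only [ambientMomentum_l, ambientMomentum_x, ambientMomentum_p, ambientMomentum_I]
    field_simp
    ring
  · intro i j k
    simp only [ambientMomentum_l, ambientMomentum_x]
    ring
  · intro i j k
    simp only [ambientMomentum_l, ambientMomentum_p]
    ring
  · intro i j k m
    simp only [ambientMomentum_l]
    ring

/-- The covector is recovered by evaluating `ξ` on the rotations at `q`. Let `J` be the bivector on
`ℝ × ℝⁿ` with entries `l` and `m`. The relations `htl` and `hly` say `q ∧ J = 0`; contracting with
`q` and using `⟨q, q⟩ = 1` gives `J = q ∧ P`. -/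
theorem eq_ambientMomentum {ξ : DefLieDual n ε} (hξ : ξ ∈ specialOrbit n ε) :
    c.basePoint ξ ∈ c.quadric n ∧
      ξ = c.ambientMomentum (c.basePoint ξ) (ξ.comp (c.rotation (c.basePoint ξ))) := by
  have hN := c.ne_zero
  obtain ⟨hC, hIl, hlx, hlp, -⟩ := hξ
  have hq : (c.basePoint ξ).1 ^ 2 + c.s * ((c.basePoint ξ).2 ⬝ᵥ (c.basePoint ξ).2) = 1 := by
    rw [c.casimir_eq] at hC
    linarith
  refine ⟨hq, ?_⟩
  set q := c.basePoint ξ with hqdef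
  have hq1 : ξ (DefLie.I n ε) = q.1 := rfl
  have hq2 : ∀ i, q.2 i = c.β * ξ (DefLie.x n ε i) - c.α * ξ (DefLie.p n ε i) := fun _ => rfl
  -- `m` is the boost momentum; `(x, p) ↦ (m, q.2)` is an invertible change of coordinates, inverted
  -- by `hx` and `hp`.
  set m : Fin n → ℝ := fun i =>
    (c.α * ξ (DefLie.x n ε i) + c.β * ξ (DefLie.p n ε i)) / (c.α ^ 2 + c.β ^ 2) with hm
  have hx : ∀ i, ξ (DefLie.x n ε i) = c.α * m i + c.β / (c.α ^ 2 + c.β ^ 2) * q.2 i := by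
    intro i; rw [hq2, hm]; field_simp; ring
  have hp : ∀ i, ξ (DefLie.p n ε i) = c.β * m i - c.α / (c.α ^ 2 + c.β ^ 2) * q.2 i := by
    intro i; rw [hq2, hm]; field_simp; ring
  have htl : ∀ i j, q.1 * ξ (DefLie.l n ε i j) = q.2 i * m j - q.2 j * m i := by
    intro i j
    rw [← hq1, hIl, hx, hp, hx, hp]
    field_simp
    ring
  have hly : ∀ i j k, q.2 j * ξ (DefLie.l n ε i k) - q.2 k * ξ (DefLie.l n ε i j) =
      q.2 i * ξ (DefLie.l n ε j k) := by
    intro i j k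
    rw [hq2, hq2, hq2]
    -- The Plücker relations for `x` and for `p` combine in the same way as `q.2 = β x - α p`.
    linear_combination (-c.β) * hlx i j k + c.α * hlp i j k
  have hrot : ∀ v : ℝ × (Fin n → ℝ), (ξ.comp (c.rotation q)) v =
      (∑ i, ∑ j, (c.s * (q.2 i * v.2 j)) * ξ (DefLie.l n ε i j)) +
        ∑ i, (q.1 * v.2 i - v.1 * q.2 i) * m i := by
    intro v
    rw [ContinuousLinearMap.comp_apply, rotation_apply]
    simp only [map_add, map_sum, map_smul, smul_eq_mul, hm]
    congr 1
    exact Finset.sum_congr rfl fun i _ => by ring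
  have hz : ∀ k, (ξ.comp (c.rotation q)) (0, Pi.single k 1) =
      c.s * ∑ i, q.2 i * ξ (DefLie.l n ε i k) + q.1 * m k := by
    intro k
    rw [hrot, Finset.mul_sum]
    simp [Pi.single_apply, mul_assoc]
  have hw : (ξ.comp (c.rotation q)) (1, 0) = -∑ i, q.2 i * m i := by
    rw [hrot]
    simp
  have hyy : c.s * ∑ i, q.2 i * q.2 i = 1 - q.1 ^ 2 := by
    have : q.2 ⬝ᵥ q.2 = ∑ i, q.2 i * q.2 i := rfl
    rw [← this]; linarith
  have hml : ∀ k, q.1 * (c.s * ∑ i, q.2 i * ξ (DefLie.l n ε i k) + q.1 * m k)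
      + c.s * q.2 k * ∑ i, q.2 i * m i = m k := by
    intro k
    have h1 : q.1 * ∑ i, q.2 i * ξ (DefLie.l n ε i k) =
        (∑ i, q.2 i * q.2 i) * m k - q.2 k * ∑ i, q.2 i * m i := by
      rw [Finset.mul_sum, Finset.mul_sum, Finset.sum_mul, ← Finset.sum_sub_distrib]
      refine Finset.sum_congr rfl fun i _ => ?_
      linear_combination q.2 i * htl i k
    linear_combination c.s * h1 + m k * hyy
  refine dual_ext (fun j k => ?_) (fun k => ?_) (fun k => ?_) ?_
  · rw [ambientMomentum_l, hz, hz]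
    have h1 : q.2 j * ∑ i, q.2 i * ξ (DefLie.l n ε i k) - q.2 k * ∑ i, q.2 i * ξ (DefLie.l n ε i j)
        = (∑ i, q.2 i * q.2 i) * ξ (DefLie.l n ε j k) := by
      rw [Finset.mul_sum, Finset.mul_sum, Finset.sum_mul, ← Finset.sum_sub_distrib]
      refine Finset.sum_congr rfl fun i _ => ?_
      linear_combination q.2 i * hly i j k
    linear_combination (-c.s) * h1 - ξ (DefLie.l n ε j k) * hyy + q.1 * htl j k
  · rw [ambientMomentum_x, hz, hw, hx]
    linear_combination (-c.α) * hml k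
  · rw [ambientMomentum_p, hz, hw, hp]
    linear_combination (-c.β) * hml k
  · rw [ambientMomentum_I, hq1]

theorem specialOrbit_eq : specialOrbit n ε =
    {ξ | ∃ q ∈ c.quadric n, ∃ P, c.ambientMomentum q P = ξ} := by
  ext ξ
  constructor
  · intro hξ
    obtain ⟨h1, h2⟩ := c.eq_ambientMomentum hξ
    exact ⟨_, h1, _, h2.symm⟩
  · rintro ⟨q, hq, P, rfl⟩
    exact c.ambientMomentum_mem hq P

theorem continuous_ambientMomentum :
    Continuous fun z : (ℝ × (Fin n → ℝ)) × ((ℝ × (Fin n → ℝ)) →L[ℝ] ℝ) =>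
      c.ambientMomentum z.1 z.2 := by
  rw [continuous_clm_apply]
  intro X
  simp only [ambientMomentum_apply]
  fun_prop

/-! ### Momentum maps of manifolds embedded in the quadric. -/

section Manifold

variable {E : Type*} [NormedAddCommGroup E] [NormedSpace ℝ E]
  {M : Type*} [TopologicalSpace M] [ChartedSpace E M] [IsManifold 𝓘(ℝ, E) ∞ M]

/-- An embedding of a manifold onto an open and closed part of the quadric. -/
structure IsQuadricEmbedding (ι : M → ℝ × (Fin n → ℝ)) : Prop where
  contMDiff : ContMDiff 𝓘(ℝ, E) 𝓘(ℝ, ℝ × (Fin n → ℝ)) ∞ ι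
  isEmbedding : IsEmbedding ι
  injective : ∀ q, Function.Injective (mfderiv 𝓘(ℝ, E) 𝓘(ℝ, ℝ × (Fin n → ℝ)) ι q)
  mem_quadric : ∀ q, ι q ∈ c.quadric n
  mem_range_iff : ∀ q (v : ℝ × (Fin n → ℝ)), v ∈ range (modelDeriv E ι q) ↔
    (ι q).1 * v.1 + c.s * ((ι q).2 ⬝ᵥ v.2) = 0

variable {c}

omit [IsManifold 𝓘(ℝ, E) ∞ M] in
theorem IsQuadricEmbedding.isHomogeneous {ι : M → ℝ × (Fin n → ℝ)}
    (h : c.IsQuadricEmbedding (E := E) ι) : c.action.IsHomogeneous (E := E) ι where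
  contMDiff := h.contMDiff
  isEmbedding := h.isEmbedding
  injective := h.injective
  mem_range X q := by
    refine (h.mem_range_iff q _).2 ?_
    change (ι q).1 * (c.linearField X (ι q)).1 + c.s * ((ι q).2 ⬝ᵥ (c.linearField X (ι q)).2) = 0
    have h0 := dotProduct_rot_mulVec X (ι q).2 (ι q).2
    rw [dotProduct_comm (rot X *ᵥ _)] at h0
    have h0 : (ι q).2 ⬝ᵥ (rot X *ᵥ (ι q).2) = 0 := by linarith
    rw [linearField_apply, dotProduct_sub, dotProduct_smul, h0, dotProduct_comm (c.boost X),
      smul_eq_mul]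
    ring
  A_R q := fun (v : ℝ × (Fin n → ℝ)) hv => by
    have h1 := (h.mem_range_iff q v).1 hv
    have h2 : (ι q).1 ^ 2 + c.s * ((ι q).2 ⬝ᵥ (ι q).2) = 1 := h.mem_quadric q
    have h3 := c.linearField_rotation (ι q) v
    rw [h2, h1, one_smul, zero_smul, sub_zero] at h3
    exact h3

omit [IsManifold 𝓘(ℝ, E) ∞ M] in
-- Covectors on `M` extend to `ℝ × ℝⁿ` through a left inverse of `dι`. Conversely only the
-- restriction of `P` to tangent vectors matters, since `A X q` is tangent.
theorem IsQuadricEmbedding.range_momentum {ι : M → ℝ × (Fin n → ℝ)}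
    (h : c.IsQuadricEmbedding (E := E) ι) :
    range (momentum c.action ι : CotangentBundle E M → DefLieDual n ε) =
      {ξ | ∃ q ∈ range ι, ∃ P, c.ambientMomentum q P = ξ} := by
  apply Subset.antisymm
  · rintro _ ⟨z, rfl⟩
    refine ⟨_, ⟨z.proj, rfl⟩,
      (covector z).comp (LinearMap.toContinuousLinearMap (derivLeftInverse E ι z.proj)), ?_⟩
    rfl
  · rintro _ ⟨_, ⟨q, rfl⟩, P, rfl⟩
    refine ⟨⟨q, P.comp (modelDeriv E ι q)⟩, ?_⟩
    refine ContinuousLinearMap.ext fun X => ?_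
    have h1 := h.isHomogeneous.modelDeriv_derivLeftInverse q X
    rw [momentum_apply]
    change P (modelDeriv E ι q (derivLeftInverse E ι q (c.action.A X (ι q)))) + _ = _
    rw [h1]
    rfl

theorem IsQuadricEmbedding.symplectomorphic [FiniteDimensional ℝ E] {ι : M → ℝ × (Fin n → ℝ)}
    (h : c.IsQuadricEmbedding (E := E) ι) :
    SymplectomorphicToCotangent E M {ξ | ∃ q ∈ range ι, ∃ P, c.ambientMomentum q P = ξ} := by
  refine ⟨momentum c.action ι, ?_⟩
  rw [← h.range_momentum]
  exact h.isHomogeneous.isSymplectomorphismOnto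

end Manifold

end ConeParam

/-! ### Sphere and hyperboloid -/

section Sphere

variable (n : ℕ)

/-- The splitting `ℝⁿ⁺¹ = ℝ × ℝⁿ`. -/
def splitTime : EuclideanSpace ℝ (Fin (n + 1)) →L[ℝ] ℝ × (Fin n → ℝ) :=
  LinearMap.toContinuousLinearMap
    { toFun := fun v => (v 0, fun i => v i.succ)
      map_add' := fun _ _ => rfl
      map_smul' := fun _ _ => rfl }

variable {n}

theorem splitTime_apply (v : EuclideanSpace ℝ (Fin (n + 1))) :
    splitTime n v = (v 0, fun i => v i.succ) := rfl

theorem splitTime_bijective : Function.Bijective (splitTime n) := by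
  constructor
  · intro v w h
    rw [splitTime_apply, splitTime_apply, Prod.mk.injEq] at h
    ext i
    refine Fin.cases h.1 (fun j => congrFun h.2 j) i
  · rintro ⟨t, y⟩
    exact ⟨WithLp.toLp 2 (Fin.cons t y), by simp [splitTime_apply]⟩

theorem inner_eq_splitTime (v w : EuclideanSpace ℝ (Fin (n + 1))) : inner ℝ v w =
    (splitTime n v).1 * (splitTime n w).1 + (splitTime n v).2 ⬝ᵥ (splitTime n w).2 := by
  rw [PiLp.inner_apply, Fin.sum_univ_succ]
  simp [splitTime_apply, dotProduct, mul_comm]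

instance fact_finrank_euclideanSpace_succ :
    Fact (Module.finrank ℝ (EuclideanSpace ℝ (Fin (n + 1))) = n + 1) :=
  ⟨finrank_euclideanSpace_fin⟩

/-- The embedding of the unit sphere in `ℝ × ℝⁿ`. -/
def sphereEmbedding (n : ℕ) (q : UnitSphere n) : ℝ × (Fin n → ℝ) := splitTime n q

theorem modelDeriv_sphereEmbedding (q : UnitSphere n) :
    modelDeriv (EuclideanSpace ℝ (Fin n)) (sphereEmbedding n) q =
      (splitTime n).comp (modelDeriv (EuclideanSpace ℝ (Fin n))
        (Subtype.val : UnitSphere n → EuclideanSpace ℝ (Fin (n + 1))) q) := by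
  have h1 : MDifferentiableAt (𝓡 n) 𝓘(ℝ, EuclideanSpace ℝ (Fin (n + 1)))
      (Subtype.val : UnitSphere n → EuclideanSpace ℝ (Fin (n + 1))) q :=
    (contMDiff_coe_sphere (m := ∞)).mdifferentiableAt (by simp)
  have h2 : MDifferentiableAt 𝓘(ℝ, EuclideanSpace ℝ (Fin (n + 1))) 𝓘(ℝ, ℝ × (Fin n → ℝ))
      (splitTime n) q.1 := (splitTime n).differentiableAt.mdifferentiableAt
  have h3 := mfderiv_comp q h2 h1
  rw [mfderiv_eq_fderiv, (splitTime n).fderiv] at h3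
  exact h3

theorem isQuadricEmbedding_sphere {ε : Params} (c : ConeParam ε) (hs : c.s = 1) :
    c.IsQuadricEmbedding (E := EuclideanSpace ℝ (Fin n)) (sphereEmbedding n) where
  contMDiff := (splitTime n).contDiff.contMDiff.comp contMDiff_coe_sphere
  isEmbedding := (LinearMap.isClosedEmbedding_of_injective (f := (splitTime n).toLinearMap)
    (LinearMap.ker_eq_bot.2 splitTime_bijective.1)).isEmbedding.comp .subtypeVal
  injective q := by
    change Function.Injective (modelDeriv (EuclideanSpace ℝ (Fin n)) (sphereEmbedding n) q)
    rw [modelDeriv_sphereEmbedding]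
    exact splitTime_bijective.1.comp (injective_mvfderiv_subtypeVal_sphere q)
  mem_quadric q := by
    have h1 := inner_eq_splitTime q.1 q.1
    rw [real_inner_self_eq_norm_sq, mem_sphere_zero_iff_norm.1 q.2] at h1
    change (splitTime n q).1 ^ 2 + c.s * ((splitTime n q).2 ⬝ᵥ (splitTime n q).2) = 1
    rw [hs, one_mul, sq, ← h1]
    norm_num
  mem_range_iff q v := by
    obtain ⟨w, rfl⟩ := splitTime_bijective.2 v
    have h1 : w ∈ range (modelDeriv (EuclideanSpace ℝ (Fin n))
        (Subtype.val : UnitSphere n → EuclideanSpace ℝ (Fin (n + 1))) q) ↔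
        inner ℝ (q : EuclideanSpace ℝ (Fin (n + 1))) w = 0 := by
      -- The tangent space of the sphere at `q` is the orthogonal complement of `q`.
      rw [← Submodule.mem_orthogonal_singleton_iff_inner_right,
        ← range_mvfderiv_subtypeVal (n := n) q]
      rfl
    rw [modelDeriv_sphereEmbedding, hs, one_mul]
    change _ ↔ (splitTime n q).1 * (splitTime n w).1 + (splitTime n q).2 ⬝ᵥ (splitTime n w).2 = 0
    rw [← inner_eq_splitTime, ← h1, ContinuousLinearMap.coe_comp, range_comp,
      splitTime_bijective.1.mem_set_image]

theorem range_sphereEmbedding {ε : Params} (c : ConeParam ε) (hs : c.s = 1) :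
    range (sphereEmbedding n) = c.quadric n := by
  apply Subset.antisymm
  · rintro _ ⟨q, rfl⟩
    exact (isQuadricEmbedding_sphere c hs).mem_quadric q
  · intro v hv
    obtain ⟨w, rfl⟩ := splitTime_bijective.2 v
    refine ⟨⟨w, ?_⟩, rfl⟩
    have h1 := inner_eq_splitTime w w
    have h2 : (splitTime n w).1 ^ 2 + c.s * ((splitTime n w).2 ⬝ᵥ (splitTime n w).2) = 1 := hv
    rw [hs, one_mul, sq, ← h1, real_inner_self_eq_norm_sq] at h2
    rw [mem_sphere_zero_iff_norm]
    exact (pow_eq_one_iff_of_nonneg (norm_nonneg w) two_ne_zero).1 h2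

end Sphere

section Hyperboloid

variable {n : ℕ}

/-- The graph parametrization of the sheet `σ t > 0` of the hyperboloid `t² - |y|² = 1`, where
`σ = ±1`. -/
def hyperboloidGraph (n : ℕ) (σ : ℝ) (y : EuclideanSpace ℝ (Fin n)) : ℝ × (Fin n → ℝ) :=
  (σ * √(1 + ‖y‖ ^ 2), σ • WithLp.ofLp y)

/-- The embedding of hyperbolic space in `ℝ × ℝⁿ` as the sheet `σ t > 0`. -/
def hyperbolicEmbedding (n : ℕ) (σ : ℝ) (q : HyperbolicSpace n) : ℝ × (Fin n → ℝ) :=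
  hyperboloidGraph n σ (HyperbolicSpace.homeo n q)

theorem contDiff_hyperboloidGraph (σ : ℝ) : ContDiff ℝ ∞ (hyperboloidGraph n σ) := by
  refine ContDiff.prodMk ?_ ?_
  · refine contDiff_const.mul (ContDiff.sqrt (contDiff_const.add (contDiff_norm_sq ℝ)) fun y => ?_)
    positivity
  · exact (EuclideanSpace.equiv (Fin n) ℝ).contDiff.const_smul σ

theorem fderiv_hyperboloidGraph (σ : ℝ) (y e : EuclideanSpace ℝ (Fin n)) :
    fderiv ℝ (hyperboloidGraph n σ) y e =
      (σ * (inner ℝ y e / √(1 + ‖y‖ ^ 2)), σ • WithLp.ofLp e) := by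
  have h0 : (1 + ‖y‖ ^ 2) ≠ 0 := by positivity
  have h1 := (((hasStrictFDerivAt_norm_sq y).hasFDerivAt.const_add 1).sqrt h0).const_mul σ
  have h2 := ((EuclideanSpace.equiv (Fin n) ℝ).hasFDerivAt (x := y)).const_smul σ
  have h3 := (h1.prodMk h2).fderiv
  change fderiv ℝ (hyperboloidGraph n σ) y = _ at h3
  rw [h3]
  have h4 : √(1 + ‖y‖ ^ 2) ≠ 0 := by positivity
  refine Prod.ext ?_ ?_
  · simp only [ContinuousLinearMap.prod_apply, _root_.smul_apply, smul_eq_mul, nsmul_eq_mul,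
      Nat.cast_ofNat, innerSL_apply_apply]
    field_simp
  · simp
    rfl

theorem dotProduct_ofLp (v w : EuclideanSpace ℝ (Fin n)) :
    WithLp.ofLp v ⬝ᵥ WithLp.ofLp w = inner ℝ v w := by
  rw [PiLp.inner_apply, dotProduct]
  simp [mul_comm]

theorem contMDiff_homeo : ContMDiff (𝓡 n) 𝓘(ℝ, EuclideanSpace ℝ (Fin n)) ∞
    (HyperbolicSpace.homeo n) := fun q =>
  contMDiffAt_extChartAt (I := 𝓡 n) (x := q)

/-- `homeo` is itself the preferred chart at every point. -/
theorem bijective_mfderiv_homeo (q : HyperbolicSpace n) : Function.Bijective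
    (modelDeriv (EuclideanSpace ℝ (Fin n)) (HyperbolicSpace.homeo n) q) := by
  have : IsManifold (𝓡 n) 1 (HyperbolicSpace n) := IsManifold.of_le (n := ∞) (by simp)
  exact (isInvertible_mfderiv_extChartAt (I := 𝓡 n) (mem_extChartAt_source (I := 𝓡 n) q)).bijective

theorem modelDeriv_hyperbolicEmbedding (σ : ℝ) (q : HyperbolicSpace n) :
    modelDeriv (EuclideanSpace ℝ (Fin n)) (hyperbolicEmbedding n σ) q =
      (fderiv ℝ (hyperboloidGraph n σ) (HyperbolicSpace.homeo n q)).comp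
        (modelDeriv (EuclideanSpace ℝ (Fin n)) (HyperbolicSpace.homeo n) q) := by
  have h3 := mfderiv_comp q (((contDiff_hyperboloidGraph (n := n) σ).differentiable
    (by simp)).differentiableAt (x := HyperbolicSpace.homeo n q)).mdifferentiableAt
    ((contMDiff_homeo (n := n)).mdifferentiableAt (x := q) (by simp))
  rw [mfderiv_eq_fderiv] at h3
  exact h3

theorem hyperboloidGraph_mem_quadric {ε : Params} (c : ConeParam ε) (hs : c.s = -1) {σ : ℝ}
    (hσ : σ * σ = 1) (y : EuclideanSpace ℝ (Fin n)) : hyperboloidGraph n σ y ∈ c.quadric n := by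
  change (σ * √(1 + ‖y‖ ^ 2)) ^ 2 + c.s * ((σ • WithLp.ofLp y) ⬝ᵥ (σ • WithLp.ofLp y)) = 1
  rw [hs, smul_dotProduct, dotProduct_smul, dotProduct_ofLp, real_inner_self_eq_norm_sq, mul_pow,
    Real.sq_sqrt (by positivity), smul_eq_mul, smul_eq_mul]
  linear_combination hσ

theorem isQuadricEmbedding_hyperbolic {ε : Params} (c : ConeParam ε) (hs : c.s = -1) {σ : ℝ}
    (hσ : σ * σ = 1) :
    c.IsQuadricEmbedding (E := EuclideanSpace ℝ (Fin n)) (hyperbolicEmbedding n σ) where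
  contMDiff := (contDiff_hyperboloidGraph σ).contMDiff.comp contMDiff_homeo
  isEmbedding := by
    have h1 : Function.LeftInverse (fun v : ℝ × (Fin n → ℝ) => WithLp.toLp 2 (σ • v.2))
        (hyperboloidGraph n σ) := fun y => by
      simp [hyperboloidGraph, smul_smul, hσ]
    exact (h1.isEmbedding (by fun_prop) (contDiff_hyperboloidGraph σ).continuous).comp
      (HyperbolicSpace.homeo n).isEmbedding
  injective q := by
    change Function.Injective (modelDeriv (EuclideanSpace ℝ (Fin n)) (hyperbolicEmbedding n σ) q)
    rw [modelDeriv_hyperbolicEmbedding, ContinuousLinearMap.coe_comp]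
    refine Function.Injective.comp (fun e e' h => ?_) (bijective_mfderiv_homeo q).1
    rw [fderiv_hyperboloidGraph, fderiv_hyperboloidGraph, Prod.mk.injEq] at h
    have h2 := congrArg (σ • ·) h.2
    simp only [smul_smul, hσ, one_smul] at h2
    exact (WithLp.ofLp_injective 2) h2
  mem_quadric q := hyperboloidGraph_mem_quadric c hs hσ _
  mem_range_iff q v := by
    rw [modelDeriv_hyperbolicEmbedding, ContinuousLinearMap.coe_comp,
      (bijective_mfderiv_homeo q).2.range_comp, hs]
    set y := HyperbolicSpace.homeo n q
    have h4 : √(1 + ‖y‖ ^ 2) ≠ 0 := by positivity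
    change _ ↔ (σ * √(1 + ‖y‖ ^ 2)) * v.1 + -1 * ((σ • WithLp.ofLp y) ⬝ᵥ v.2) = 0
    constructor
    · rintro ⟨e, rfl⟩
      rw [fderiv_hyperboloidGraph]
      simp only [smul_dotProduct, dotProduct_smul, dotProduct_ofLp, smul_eq_mul]
      field_simp
      ring
    · intro h
      -- The second component of the graph is `σ • y`, so `σ • v.2` is the only candidate; tangency
      -- then fixes the first component.
      refine ⟨WithLp.toLp 2 (σ • v.2), ?_⟩
      rw [fderiv_hyperboloidGraph, ← dotProduct_ofLp]
      have h5 : √(1 + ‖y‖ ^ 2) * v.1 = WithLp.ofLp y ⬝ᵥ v.2 := by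
        rw [smul_dotProduct, smul_eq_mul] at h
        linear_combination σ * h + (WithLp.ofLp y ⬝ᵥ v.2 - √(1 + ‖y‖ ^ 2) * v.1) * hσ
      refine Prod.ext ?_ ?_
      · simp only [dotProduct_smul, smul_eq_mul, ← h5]
        field_simp
        linear_combination v.1 * hσ
      · simp [smul_smul, hσ]

theorem range_hyperbolicEmbedding {ε : Params} (c : ConeParam ε) (hs : c.s = -1) {σ : ℝ}
    (hσ : σ * σ = 1) :
    range (hyperbolicEmbedding n σ) = {q ∈ c.quadric n | 0 < σ * q.1} := by
  apply Subset.antisymm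
  · rintro _ ⟨q, rfl⟩
    refine ⟨hyperboloidGraph_mem_quadric c hs hσ _, ?_⟩
    simp only [hyperbolicEmbedding, hyperboloidGraph, ← mul_assoc, hσ, one_mul]
    positivity
  · rintro ⟨t, y⟩ ⟨hq, ht⟩
    have hq : t ^ 2 + c.s * (y ⬝ᵥ y) = 1 := hq
    refine ⟨(HyperbolicSpace.homeo n).symm (WithLp.toLp 2 (σ • y)), ?_⟩
    have h1 : 1 + ‖WithLp.toLp 2 (σ • y)‖ ^ 2 = (σ * t) ^ 2 := by
      rw [← real_inner_self_eq_norm_sq, ← dotProduct_ofLp]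
      simp only [smul_dotProduct, dotProduct_smul, smul_eq_mul]
      rw [hs] at hq
      linear_combination -hq + (y ⬝ᵥ y - t ^ 2) * hσ
    rw [hyperbolicEmbedding, Homeomorph.apply_symm_apply, hyperboloidGraph, h1,
      Real.sqrt_sq (le_of_lt ht), ← mul_assoc, hσ, one_mul]
    simp [smul_smul, hσ]

instance connectedSpace_hyperbolic : ConnectedSpace (HyperbolicSpace n) :=
  (HyperbolicSpace.homeo n).symm.surjective.connectedSpace (HyperbolicSpace.homeo n).symm.continuous

end Hyperboloid

/-! ### The special orbits over the real flat cone -/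

/-- `α` and `β` are square roots of `s ε₁` and `s ε₂`; the sign of `s ε₃` is absorbed into `β`. -/
theorem exists_coneParam {ε : Params} (h0 : ε ≠ ⟨0, 0, 0⟩) (h3 : ε.ε₃ ^ 2 = ε.ε₁ * ε.ε₂) {s : ℝ}
    (hs : s * s = 1) (h1 : 0 ≤ s * ε.ε₁) (h2 : 0 ≤ s * ε.ε₂) : ∃ c : ConeParam ε, c.s = s := by
  have e1 := Real.sq_sqrt h1
  have e2 := Real.sq_sqrt h2
  have hsq : (s * ε.ε₃) ^ 2 = (√(s * ε.ε₁) * √(s * ε.ε₂)) ^ 2 := by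
    rw [mul_pow, mul_pow, e1, e2, h3]; ring
  obtain ⟨β, hβ, hαβ⟩ : ∃ β, β ^ 2 = s * ε.ε₂ ∧ s * ε.ε₃ = √(s * ε.ε₁) * β := by
    rcases sq_eq_sq_iff_eq_or_eq_neg.1 hsq with h | h
    · exact ⟨_, e2, h⟩
    · exact ⟨-√(s * ε.ε₂), by rw [neg_sq, e2], by rw [h]; ring⟩
  have f1 : ε.ε₁ = s * √(s * ε.ε₁) ^ 2 := by rw [e1]; linear_combination (-ε.ε₁) * hs
  have f2 : ε.ε₂ = s * β ^ 2 := by rw [hβ]; linear_combination (-ε.ε₂) * hs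
  have f3 : ε.ε₃ = s * √(s * ε.ε₁) * β := by
    rw [mul_assoc, ← hαβ]; linear_combination (-ε.ε₃) * hs
  refine ⟨⟨√(s * ε.ε₁), β, s, hs, fun hN => h0 ?_, f1, f2, f3⟩, rfl⟩
  have g1 : √(s * ε.ε₁) = 0 := by
    have := sq_nonneg (√(s * ε.ε₁)); have := sq_nonneg β
    exact pow_eq_zero_iff (two_ne_zero) |>.1 (by linarith)
  have g2 : β = 0 := by
    rw [g1] at hN
    simpa using hN
  rw [g1] at f1 f3
  rw [g2] at f2
  ext <;> simp_all

namespace ConeParam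

variable {n : ℕ} {ε : Params} (c : ConeParam ε)

theorem symplectomorphic_sphere (hs : c.s = 1) :
    SymplectomorphicToCotangent (EuclideanSpace ℝ (Fin n)) (UnitSphere n) (specialOrbit n ε) := by
  have h := (isQuadricEmbedding_sphere (n := n) c hs).symplectomorphic
  rwa [range_sphereEmbedding c hs, ← c.specialOrbit_eq] at h

theorem sheet_eq (hs : c.s = -1) {σ : ℝ} (hσ : σ * σ = 1) :
    {ξ ∈ specialOrbit n ε | 0 < σ * ξ (DefLie.I n ε)} =
      {ξ | ∃ q ∈ range (hyperbolicEmbedding n σ), ∃ P, c.ambientMomentum q P = ξ} := by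
  rw [range_hyperbolicEmbedding c hs hσ, c.specialOrbit_eq]
  ext ξ
  constructor
  · rintro ⟨⟨q, hq, P, rfl⟩, h⟩
    rw [ambientMomentum_I] at h
    exact ⟨q, ⟨hq, h⟩, P, rfl⟩
  · rintro ⟨q, ⟨hq, h⟩, P, rfl⟩
    refine ⟨⟨q, hq, P, rfl⟩, ?_⟩
    rwa [ambientMomentum_I]

/-- The piece is the continuous image of a sheet, itself an image of `ℍⁿ`, times a vector space of
covectors. -/
theorem isConnected_sheet (hs : c.s = -1) {σ : ℝ} (hσ : σ * σ = 1) :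
    IsConnected {ξ ∈ specialOrbit n ε | 0 < σ * ξ (DefLie.I n ε)} := by
  rw [c.sheet_eq hs hσ]
  have h := ((isConnected_range
    (isQuadricEmbedding_hyperbolic (n := n) c hs hσ).isEmbedding.continuous).prod
    (isConnected_univ (α := (ℝ × (Fin n → ℝ)) →L[ℝ] ℝ))).image _
      c.continuous_ambientMomentum.continuousOn
  convert h using 1
  ext ξ
  constructor
  · rintro ⟨q, hq, P, rfl⟩
    exact ⟨(q, P), ⟨hq, mem_univ _⟩, rfl⟩
  · rintro ⟨⟨q, P⟩, ⟨hq, -⟩, rfl⟩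
    exact ⟨q, hq, P, rfl⟩

theorem symplectomorphic_sheet (hs : c.s = -1) {σ : ℝ} (hσ : σ * σ = 1) :
    SymplectomorphicToCotangent (EuclideanSpace ℝ (Fin n)) (HyperbolicSpace n)
      {ξ ∈ specialOrbit n ε | 0 < σ * ξ (DefLie.I n ε)} := by
  rw [c.sheet_eq hs hσ]
  exact (isQuadricEmbedding_hyperbolic (n := n) c hs hσ).symplectomorphic

theorem ne_zero_of_mem_specialOrbit (hs : c.s = -1) {ξ : DefLieDual n ε}
    (hξ : ξ ∈ specialOrbit n ε) : ξ (DefLie.I n ε) ≠ 0 := by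
  rw [c.specialOrbit_eq] at hξ
  obtain ⟨q, hq, P, rfl⟩ := hξ
  have hq : q.1 ^ 2 + c.s * (q.2 ⬝ᵥ q.2) = 1 := hq
  rw [ambientMomentum_I]
  intro h0
  have := dotProduct_self_star_nonneg q.2
  rw [star_trivial] at this
  rw [hs, h0] at hq
  linarith

/-- The sets `σ I > 0` and `σ I < 0` are open, disjoint and cover the orbit, as `I` has no zero on
it. A component therefore stays on one side, and each side is connected. -/
theorem connectedComponentIn_sheet (hs : c.s = -1) {σ : ℝ} (hσ : σ * σ = 1) {ξ : DefLieDual n ε}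
    (hξ : ξ ∈ {ξ ∈ specialOrbit n ε | 0 < σ * ξ (DefLie.I n ε)}) :
    connectedComponentIn (specialOrbit n ε) ξ =
      {ξ ∈ specialOrbit n ε | 0 < σ * ξ (DefLie.I n ε)} := by
  have hσ0 : σ ≠ 0 := by rintro rfl; simp at hσ
  apply Subset.antisymm
  · have hcont : Continuous fun η : DefLieDual n ε => σ * η (DefLie.I n ε) := by fun_prop
    have hsub := connectedComponentIn_subset (specialOrbit n ε) ξ
    have h := (isPreconnected_connectedComponentIn (F := specialOrbit n ε) (x := ξ)
      ).subset_left_of_subset_union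
      (isOpen_lt continuous_const hcont) (isOpen_lt hcont continuous_const)
      (disjoint_left.2 fun η (h1 : 0 < σ * η (DefLie.I n ε))
        (h2 : σ * η (DefLie.I n ε) < 0) => lt_asymm h1 h2)
      (fun η hη => (mul_ne_zero hσ0 (c.ne_zero_of_mem_specialOrbit hs (hsub hη))).lt_or_gt.symm)
      ⟨ξ, mem_connectedComponentIn hξ.1, hξ.2⟩
    exact fun η hη => ⟨hsub hη, h hη⟩
  · exact (c.isConnected_sheet hs hσ).isPreconnected.subset_connectedComponentIn hξ fun η hη => hη.1

end ConeParam

theorem specialOrbitPos_eq_sheet (n : ℕ) (ε : Params) : specialOrbitPos n ε =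
    {ξ ∈ specialOrbit n ε | 0 < (1 : ℝ) * ξ (DefLie.I n ε)} := by
  simp only [one_mul]
  rfl

theorem specialOrbitNeg_eq_sheet (n : ℕ) (ε : Params) : specialOrbitNeg n ε =
    {ξ ∈ specialOrbit n ε | 0 < (-1 : ℝ) * ξ (DefLie.I n ε)} := by
  simp only [neg_one_mul, Left.neg_pos_iff]
  rfl

end

theorem proposition3p10 (n : ℕ) (hn : 3 ≤ n) (ε : Params) :
    (ε ∈ Cplus →
      SymplectomorphicToCotangent (EuclideanSpace ℝ (Fin n)) (UnitSphere n) (specialOrbit n ε)) ∧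
    (ε ∈ Cminus →
      specialOrbit n ε = specialOrbitPos n ε ∪ specialOrbitNeg n ε ∧
      Disjoint (specialOrbitPos n ε) (specialOrbitNeg n ε) ∧
      (specialOrbitPos n ε).Nonempty ∧
      (specialOrbitNeg n ε).Nonempty ∧
      (∀ ξ ∈ specialOrbitPos n ε,
        connectedComponentIn (specialOrbit n ε) ξ = specialOrbitPos n ε) ∧
      (∀ ξ ∈ specialOrbitNeg n ε,
        connectedComponentIn (specialOrbit n ε) ξ = specialOrbitNeg n ε) ∧
      SymplectomorphicToCotangent (EuclideanSpace ℝ (Fin n)) (HyperbolicSpace n)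
        (specialOrbitPos n ε) ∧
      SymplectomorphicToCotangent (EuclideanSpace ℝ (Fin n)) (HyperbolicSpace n)
        (specialOrbitNeg n ε)) := by
  refine ⟨fun hε => ?_, fun hε => ?_⟩
  · obtain ⟨h0, h3, h1, h2⟩ := hε
    obtain ⟨c, hc⟩ := exists_coneParam h0 h3 (one_mul 1) (by rwa [one_mul]) (by rwa [one_mul])
    exact c.symplectomorphic_sphere hc
  · obtain ⟨h0, h3, h1, h2⟩ := hε
    obtain ⟨c, hs⟩ := exists_coneParam h0 h3 (s := -1) (by norm_num) (by linarith) (by linarith)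
    have hp : (1 : ℝ) * 1 = 1 := one_mul 1
    have hm : (-1 : ℝ) * -1 = 1 := by norm_num
    refine ⟨?_, ?_, ?_, ?_, ?_, ?_, ?_, ?_⟩
    · ext ξ
      refine ⟨fun hξ => ?_, fun hξ => hξ.elim And.left And.left⟩
      exact (c.ne_zero_of_mem_specialOrbit hs hξ).lt_or_gt.elim
        (fun h => Or.inr ⟨hξ, h⟩) (fun h => Or.inl ⟨hξ, h⟩)
    · exact disjoint_left.2 fun ξ h h' => lt_asymm h.2 h'.2
    · rw [specialOrbitPos_eq_sheet]
      exact (c.isConnected_sheet hs hp).nonempty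
    · rw [specialOrbitNeg_eq_sheet]
      exact (c.isConnected_sheet hs hm).nonempty
    · rw [specialOrbitPos_eq_sheet]
      exact fun ξ hξ => c.connectedComponentIn_sheet hs hp hξ
    · rw [specialOrbitNeg_eq_sheet]
      exact fun ξ hξ => c.connectedComponentIn_sheet hs hm hξ
    · rw [specialOrbitPos_eq_sheet]
      exact c.symplectomorphic_sheet hs hp
    · rw [specialOrbitNeg_eq_sheet]
      exact c.symplectomorphic_sheet hs hm
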